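/- Let $d\ge1$. For $F\ge0$ on $\mathbb R^d_x\times\mathbb R^d_v$ with $\int(1+|v|^2)F(x,v)\,dv<\infty$ for every $x$, put $\rho_F=\int F\,dv$, $u_F=\rho_F^{-1}\int vF\,dv$, $\theta_F=(d\rho_F)^{-1}\int|v-u_F|^2F\,dv$ where $\rho_F>0$, and $u_F=0$, $\theta_F=1$ where $\rho_F=0$. For fields $(\rho,u,\theta)$ on $\mathbb R^d$ let $$M_{\rho,u,\theta}(x,v)=\frac{\rho(x)}{(2\pi\theta(x))^{d/2}}\exp\Bigl(-\frac{|v-u(x)|^2}{2\theta(x)}\Bigr),\qquad \mathcal M(F)=M_{\rho_F,u_F,\theta_F},$$ and $H(f\mid g)=\iint f\log\frac fg\,dv\,dx$ with $0\log0=0$. Fix constants $0<\underline\theta\le\overline\theta$, $U>0$, $0<\underline\Theta\le\overline\Theta$, $A>0$ and real numbers $K_u,K_{\nabla u},K_{\nabla\theta}$. There is a constant $C>0$, depending only on $d$ and these constants, such that the following holds for every $T\in(0,\infty)$. Let $(\rho,u,\theta)$ be a solution, smooth on $[0,T)\times\mathbb R^d$ (up to $t=0$), of the compressible Euler system $$\partial_t\rho+\nabla\cdot(\rho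 u)=0,\quad \partial_t(\rho u)+\nabla\cdot(\rho u\otimes u)+\nabla(\rho\theta)=0,\quad \partial_tE+\nabla\cdot(u(E+\rho\theta))=0,\quad E=\tfrac12\rho|u|^2+\tfrac d2\rho\theta,$$ such that (B) for all $t\in[0,T)$: $\int\rho(t,x)\,dx=1$, $\rho>0$, $\underline\theta\le\theta\le\overline\theta$, $|u|\le K_u$, $|\nabla_xu|\le K_{\nabla u}$ (operator norm) and $|\nabla_x\log\theta|\le K_{\nabla\theta}$. Let $M(t)=M_{\rho(t),u(t),\theta(t)}$. Let $I\subseteq(0,\infty)$, and for each $\varepsilon\in I$ let $f^\varepsilon\ge0$ be a solution, smooth on $[0,T)\times\mathbb R^d\times\mathbb R^d$ (up to $t=0$), of $$\partial_tf^\varepsilon+v\cdot\nabla_xf^\varepsilon=-\tfrac1\varepsilon\bigl(f^\varepsilon-\mathcal M(f^\varepsilon)\bigr),$$ with $\int(1+|v|^2)f^\varepsilon(t,x,v)\,dv<\infty$ for all $(t,x)$ and $\iint f^\varepsilon(t)\,dv\,dx=1$ for all $t\in[0,T)$. Write $u^\varepsilon,\theta^\varepsilon$ for the mean velocity and temperature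 of $f^\varepsilon$. Assume, for all $\varepsilon\in I$: (A) for all $(t,x)\in[0,T)\times\mathbb R^d$: $|u^\varepsilon|\le U$, $\underline\Theta\le\theta^\varepsilon\le\overline\Theta$ and $\iint|v|^6f^\varepsilon(t)\,dv\,dx\le A$; (Decay) $f^\varepsilon\log(f^\varepsilon/M)$ is integrable on $\mathbb R^{2d}$ for every $t\in[0,T)$; for every $b\in[0,T)$ there is $g\in L^1(\mathbb R^{2d})$ with $$|\partial_tf^\varepsilon|\bigl(1+|\log(f^\varepsilon/M)|\bigr)+f^\varepsilon|\partial_t\log M|\le g$$ for a.e. $(x,v)$ and all $t\in[0,b]$; and for every $t\in[0,T)$ the function $$|v\cdot\nabla_xf^\varepsilon|\bigl(1+|\log(f^\varepsilon/M)|\bigr)+f^\varepsilon|v\cdot\nabla_x\log M|$$ is integrable on $\mathbb R^{2d}$. (In these expressions $\log(f^\varepsilon/M)$ is read as $0$ where $f^\varepsilon=0$. The bounds in this assumption need not be uniform in $\varepsilon$.) Then, for every $\varepsilon\in I$, $t\mapsto H(f^\varepsilon(t)\mid M(t))$ is differentiable on $[0,T)$ (one-sided at $t=0$), and $$\frac{d}{dt}H(f^\varepsilon\mid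 M)\le C\bigl(H(f^\varepsilon\mid M)+\varepsilon\bigr)\qquad\text{for all }t\in[0,T).$$ Consequently, if $H(f^\varepsilon(0)\mid M(0))\to0$ as $\varepsilon\to0$ in $I$, then $$\sup_{t\in[0,T)}H\bigl(f^\varepsilon(t)\mid M(t)\bigr)\to0\qquad\text{as }\varepsilon\to0\text{ in }I.$$ -/

import Mathlib

open MeasureTheory Set Filter Topology
open scoped ContDiff

noncomputable section

namespace BGK

/-- Physical space and velocity space `ℝ^d`, with the Euclidean norm. -/
abbrev E (d : ℕ) : Type := EuclideanSpace ℝ (Fin d)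

variable {d : ℕ}

/-! ### Differential operators -/

/-- Time derivative at `t` on `[0,T)` (one-sided at `t = 0`, two-sided at `t ∈ (0,T)`). -/
def dt (T : ℝ) (g : ℝ → ℝ) (t : ℝ) : ℝ := derivWithin g (Ico 0 T) t

/-- The partial derivative `∂_i g (x)`. -/
def dx (i : Fin d) (g : E d → ℝ) (x : E d) : ℝ :=
  fderiv ℝ g x (EuclideanSpace.single i 1)

/-- The directional derivative `w · ∇g (x)`. -/
def dirDeriv (w : E d) (g : E d → ℝ) (x : E d) : ℝ := fderiv ℝ g x w

/-! ### Maxwellians, moments, relative entropy -/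

/-- The Maxwellian with density `ρ`, mean velocity `u` and temperature `θ`, at velocity `v`. -/
def maxwellian (ρ : ℝ) (u : E d) (θ : ℝ) (v : E d) : ℝ :=
  ρ / (2 * Real.pi * θ) ^ ((d : ℝ) / 2) * Real.exp (-(‖v - u‖ ^ 2 / (2 * θ)))

/-- `ρ_F(x) = ∫ F(x,v) dv`. -/
def density (F : E d → E d → ℝ) (x : E d) : ℝ := ∫ v, F x v

/-- `u_F(x) = ρ_F(x)⁻¹ ∫ v F(x,v) dv`, and `0` on the vacuum set. -/
def meanVelocity (F : E d → E d → ℝ) (x : E d) : E d :=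
  if 0 < density F x then (density F x)⁻¹ • ∫ v, F x v • v else 0

/-- `θ_F(x) = (d ρ_F(x))⁻¹ ∫ |v - u_F(x)|² F(x,v) dv`, and `1` on the vacuum set. -/
def temperature (F : E d → E d → ℝ) (x : E d) : ℝ :=
  if 0 < density F x then
    ((d : ℝ) * density F x)⁻¹ * ∫ v, ‖v - meanVelocity F x‖ ^ 2 * F x v
  else 1

/-- The local Maxwellian `𝓜(F)` with the same moments as `F`. -/
def localMaxwellian (F : E d → E d → ℝ) (x v : E d) : ℝ :=
  maxwellian (density F x) (meanVelocity F x) (temperature F x) v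

/-- The Maxwellian `M(t,x,v)` associated with the fields `(ρ,u,θ)`. -/
def targetMaxwellian (ρ : ℝ → E d → ℝ) (u : ℝ → E d → E d) (θ : ℝ → E d → ℝ)
    (t : ℝ) (x v : E d) : ℝ :=
  maxwellian (ρ t x) (u t x) (θ t x) v

/-- The integrand `f log (f / g)` of the relative entropy, as a function on phase space.
It vanishes where `f = 0`. -/
def entropyDensity (f g : E d → E d → ℝ) (p : E d × E d) : ℝ :=
  f p.1 p.2 * Real.log (f p.1 p.2 / g p.1 p.2)

/-- The relative entropy `H(f|g) = ∬ f log (f / g) dv dx`. -/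
def relEntropy (f g : E d → E d → ℝ) : ℝ := ∫ p : E d × E d, entropyDensity f g p

/-! ### The Euler system -/

/-- Total energy density `ρ|u|²/2 + d ρ θ/2`. -/
def energy (ρ : ℝ → E d → ℝ) (u : ℝ → E d → E d) (θ : ℝ → E d → ℝ) (t : ℝ) (x : E d) : ℝ :=
  ρ t x * ‖u t x‖ ^ 2 / 2 + (d : ℝ) / 2 * (ρ t x * θ t x)

/-- `(ρ,u,θ)` is a smooth solution on `[0,T) × ℝ^d` of the compressible Euler system with
pressure `ρθ`. -/
structure IsEulerSolution (T : ℝ) (ρ : ℝ → E d → ℝ) (u : ℝ → E d → E d) (θ : ℝ → E d → ℝ) :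
    Prop where
  smooth_density : ContDiffOn ℝ ∞ (fun p : ℝ × E d => ρ p.1 p.2) (Ico 0 T ×ˢ univ)
  smooth_velocity : ContDiffOn ℝ ∞ (fun p : ℝ × E d => u p.1 p.2) (Ico 0 T ×ˢ univ)
  smooth_temperature : ContDiffOn ℝ ∞ (fun p : ℝ × E d => θ p.1 p.2) (Ico 0 T ×ˢ univ)
  mass_eq : ∀ t ∈ Ico 0 T, ∀ x : E d,
    dt T (fun s => ρ s x) t + ∑ j, dx j (fun y => ρ t y * u t y j) x = 0
  momentum_eq : ∀ t ∈ Ico 0 T, ∀ x : E d, ∀ i : Fin d,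
    dt T (fun s => ρ s x * u s x i) t
      + ∑ j, dx j (fun y => ρ t y * u t y i * u t y j) x
      + dx i (fun y => ρ t y * θ t y) x = 0
  energy_eq : ∀ t ∈ Ico 0 T, ∀ x : E d,
    dt T (fun s => energy ρ u θ s x) t
      + ∑ j, dx j (fun y => u t y j * (energy ρ u θ t y + ρ t y * θ t y)) x = 0

/-- Smooth Euler background with unit mass, positive density, temperature in `[θlo, θhi]`, and
`‖u‖_∞ ≤ Ku`, `‖∇u‖_∞ ≤ Kdu`, `‖∇ log θ‖_∞ ≤ Kdθ`. -/
structure EulerBackground (T θlo θhi Ku Kdu Kdθ : ℝ)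
    (ρ : ℝ → E d → ℝ) (u : ℝ → E d → E d) (θ : ℝ → E d → ℝ) : Prop where
  euler : IsEulerSolution T ρ u θ
  unit_mass : ∀ t ∈ Ico 0 T, ∫ x, ρ t x = 1
  density_pos : ∀ t ∈ Ico 0 T, ∀ x, 0 < ρ t x
  temperature_mem : ∀ t ∈ Ico 0 T, ∀ x, θ t x ∈ Icc θlo θhi
  velocity_le : ∀ t ∈ Ico 0 T, ∀ x, ‖u t x‖ ≤ Ku
  grad_velocity_le : ∀ t ∈ Ico 0 T, ∀ x, ‖fderiv ℝ (u t) x‖ ≤ Kdu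
  grad_log_temperature_le : ∀ t ∈ Ico 0 T, ∀ x,
    ‖fderiv ℝ (fun y => Real.log (θ t y)) x‖ ≤ Kdθ

/-! ### The BGK equation -/

/-- `f` is a smooth nonnegative unit-mass solution on `[0,T) × ℝ^d × ℝ^d` of the BGK equation
with relaxation time `ε`. The field `finite_moments` says that the moments that define the local
Maxwellian exist. -/
structure IsBGKSolution (T ε : ℝ) (f : ℝ → E d → E d → ℝ) : Prop where
  smooth : ContDiffOn ℝ ∞ (fun p : ℝ × E d × E d => f p.1 p.2.1 p.2.2) (Ico 0 T ×ˢ univ)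
  nonneg : ∀ t ∈ Ico 0 T, ∀ x v, 0 ≤ f t x v
  unit_mass : ∀ t ∈ Ico 0 T, ∫ p : E d × E d, f t p.1 p.2 = 1
  finite_moments : ∀ t ∈ Ico 0 T, ∀ x, Integrable (fun v => (1 + ‖v‖ ^ 2) * f t x v)
  equation : ∀ t ∈ Ico 0 T, ∀ x v,
    dt T (fun s => f s x v) t + dirDeriv v (fun y => f t y v) x
      = -(1 / ε) * (f t x v - localMaxwellian (f t) x v)

/-- The bounds on the BGK macroscopic fields and on the sixth velocity moment. -/
structure BGKBounds (T U Θlo Θhi A : ℝ) (f : ℝ → E d → E d → ℝ) : Prop where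
  velocity_le : ∀ t ∈ Ico 0 T, ∀ x, ‖meanVelocity (f t) x‖ ≤ U
  temperature_mem : ∀ t ∈ Ico 0 T, ∀ x, temperature (f t) x ∈ Icc Θlo Θhi
  sixth_moment_integrable : ∀ t ∈ Ico 0 T,
    Integrable (fun p : E d × E d => ‖p.2‖ ^ 6 * f t p.1 p.2)
  sixth_moment_le : ∀ t ∈ Ico 0 T, ∫ p : E d × E d, ‖p.2‖ ^ 6 * f t p.1 p.2 ≤ A

/-- Decay of `f` at infinity in `(x,v)`, relative to the positive density `M`: the integrand of
`H(f|M)` is integrable; the terms of its time derivative are dominated, locally uniformly in time,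
by an integrable function; and the terms of its transport derivative `v · ∇_x` are integrable. -/
structure SufficientDecay (T : ℝ) (f M : ℝ → E d → E d → ℝ) : Prop where
  entropy_integrable : ∀ t ∈ Ico 0 T, Integrable (entropyDensity (f t) (M t))
  time_dominated : ∀ b ∈ Ico 0 T, ∃ g : E d × E d → ℝ, Integrable g ∧
    ∀ᵐ p : E d × E d, ∀ t ∈ Icc 0 b,
      |dt T (fun s => f s p.1 p.2) t| * (1 + |Real.log (f t p.1 p.2 / M t p.1 p.2)|)
        + f t p.1 p.2 * |dt T (fun s => Real.log (M s p.1 p.2)) t| ≤ g p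
  transport_integrable : ∀ t ∈ Ico 0 T, Integrable (fun p : E d × E d =>
      |dirDeriv p.2 (fun y => f t y p.2) p.1| * (1 + |Real.log (f t p.1 p.2 / M t p.1 p.2)|)
        + f t p.1 p.2 * |dirDeriv p.2 (fun y => Real.log (M t y p.2)) p.1|)

end BGK

end

namespace BGK

variable {d : ℕ}

/-! ### Real inequalities -/

/-! The proof is a relative entropy argument. Write `𝓜` for the local Maxwellian of `f`. The
transport derivative of `f log (f/M)` integrates to zero, so the time derivative of `H(f|M)` is the
integral of `(∂_t + v·∇)f · (log (f/M) + 1) - f (∂_t + v·∇) log M`.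

In the first term the BGK equation gives the factor `-(1/ε)(f - 𝓜)`. Since `log (𝓜/M) + 1` is a
quadratic polynomial in `v`, and `f` and `𝓜` have the same quadratic moments, `log (f/M) + 1` may be
replaced by `log (f/𝓜)`. This leaves the dissipation `-(1/ε)(f - 𝓜) log (f/𝓜)`.

In the second term the Euler equations turn `(∂_t + v·∇) log M` into a cubic polynomial `P` in `v -
u` whose coefficients involve only `θ`, `∇u` and `∇ log θ`
(`IsEulerSolution.transport_log_maxwellian`). Split `fP = (f - 𝓜)P + 𝓜P`. Completing a square
against the dissipation (`neg_dissipation_le`) bounds the first part by `(ε/4)(f + 𝓜)P²`, which is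
`O(ε)` by the sixth moments. The velocity integral of `𝓜P` has no terms of order zero or one in
`(u_f - u, θ_f - θ)` (`integral_maxwellian_mul_transportPoly`), and the remaining quadratic quantity
is controlled by the relative entropy (`slice_entropy_ge`); the leftover `ρ_f - ρ` integrates to
zero because both masses are one. Gronwall finishes.

The delicate point is the zero set of `f`, where `log (f/M)` is singular. There the first
derivatives of `f` vanish: at interior times by minimality, at `t = 0` by the domination hypothesis.
Hence `f log (f/M)` is still differentiable, and the equation forces `𝓜 = 0` wherever `f = 0`, so `f
> 0` almost everywhere over positions of positive density. -/

theorem sub_mul_log_div_ge {a b : ℝ} (ha : 0 < a) (hb : 0 < b) :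
    (a - b) ^ 2 / (a + b) ≤ (a - b) * Real.log (a / b) := by
  -- The claim is symmetric in `a` and `b`. For `b ≤ a` it follows from `log y ≥ 1 - 1/y`, with the
  -- denominator `a` enlarged to `a + b`.
  have key : ∀ {a b : ℝ}, 0 < a → 0 < b → b ≤ a →
      (a - b) ^ 2 / (a + b) ≤ (a - b) * Real.log (a / b) := by
    intro a b ha hb hab
    have h1 : (a - b) / a ≤ Real.log (a / b) := by
      have := Real.one_sub_inv_le_log_of_pos (div_pos ha hb)
      have e : 1 - (a / b)⁻¹ = (a - b) / a := by field_simp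
      linarith
    calc (a - b) ^ 2 / (a + b) ≤ (a - b) ^ 2 / a := by
          apply div_le_div_of_nonneg_left (sq_nonneg _) ha (by linarith)
      _ = (a - b) * ((a - b) / a) := by ring
      _ ≤ _ := mul_le_mul_of_nonneg_left h1 (by linarith)
  rcases le_total b a with h | h
  · exact key ha hb h
  · have := key hb ha h
    rw [← inv_div a b, Real.log_inv] at this
    calc (a - b) ^ 2 / (a + b) = (b - a) ^ 2 / (b + a) := by rw [add_comm a b]; ring
      _ ≤ (b - a) * -Real.log (a / b) := this
      _ = _ := by ring

/-- The dissipation controls the deviation from equilibrium tested against any weight `q`. -/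
theorem neg_dissipation_le {a b q ε : ℝ} (ha : 0 < a) (hb : 0 < b) (hε : 0 < ε) :
    -(1 / ε) * ((a - b) * Real.log (a / b)) - (a - b) * q ≤ ε / 4 * ((a + b) * q ^ 2) := by
  have h := sub_mul_log_div_ge ha hb
  have h1 : (1 / ε) * ((a - b) ^ 2 / (a + b)) ≤ (1 / ε) * ((a - b) * Real.log (a / b)) :=
    mul_le_mul_of_nonneg_left h (by positivity)
  have hab : 0 < a + b := by linarith
  -- A perfect square divided by `ε (a + b)`; this fixes the factor `ε / 4`.
  have h2 : 0 ≤ (1 / ε) * ((a - b) ^ 2 / (a + b)) + (a - b) * q + ε / 4 * ((a + b) * q ^ 2) := by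
    have : (1 / ε) * ((a - b) ^ 2 / (a + b)) + (a - b) * q + ε / 4 * ((a + b) * q ^ 2)
        = ((a - b) + ε / 2 * ((a + b) * q)) ^ 2 / (ε * (a + b)) := by
      field_simp; ring
    rw [this]; positivity
  linarith

/-- With `r = s²`, `log r ≤ 2(s - 1)` leaves `(s - 1)²`, and `(s + 1)² ≤ 2(r + 1)`. This is the
source of the coercivity in the temperature. -/
theorem sub_one_sub_log_ge {r : ℝ} (hr : 0 < r) :
    (r - 1) ^ 2 / (2 * (r + 1)) ≤ r - 1 - Real.log r := by
  set s := Real.sqrt r with hs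
  have hs0 : 0 < s := Real.sqrt_pos.2 hr
  have hsq : s ^ 2 = r := Real.sq_sqrt hr.le
  have hl : Real.log r ≤ 2 * (s - 1) := by
    rw [← hsq, Real.log_pow]
    have := Real.log_le_sub_one_of_pos hs0
    push_cast; linarith
  rw [div_le_iff₀ (by linarith)]
  have : (s - 1) ^ 2 ≤ r - 1 - Real.log r := by nlinarith
  have h3 : (r - 1) ^ 2 ≤ (s - 1) ^ 2 * (2 * (r + 1)) := by
    rw [← hsq]; nlinarith [mul_nonneg (sq_nonneg (s - 1)) (sq_nonneg (s - 1))]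
  nlinarith [mul_le_mul_of_nonneg_right this (by linarith : 0 ≤ 2 * (r + 1))]

theorem mul_log_div_ge_sub {a b : ℝ} (ha : 0 ≤ a) (hb : 0 < b) :
    a - b ≤ a * Real.log (a / b) := by
  rcases ha.eq_or_lt with rfl | ha
  · simp; linarith
  have h1 : (a - b) / a ≤ Real.log (a / b) := by
    have := Real.one_sub_inv_le_log_of_pos (div_pos ha hb)
    have e : 1 - (a / b)⁻¹ = (a - b) / a := by field_simp
    linarith
  calc a - b = a * ((a - b) / a) := by field_simp
    _ ≤ _ := mul_le_mul_of_nonneg_left h1 ha.le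

/-! ### Differentiating `q log q` at zeros of `q` -/

/-- A `C²` function that vanishes to first order at `a` vanishes quadratically. -/
theorem isBigO_sq_of_deriv_zero {S : Set ℝ} (hS : Convex ℝ S) (hu : UniqueDiffOn ℝ S) {q : ℝ → ℝ}
    (hq : ContDiffOn ℝ 2 q S) {a : ℝ} (ha : a ∈ S) (h0 : q a = 0) (h1 : derivWithin q S a = 0) :
    q =O[𝓝[S] a] fun t => (t - a) ^ 2 := by
  have hd : DifferentiableOn ℝ q S := hq.differentiableOn (by norm_num)
  have hd1 : ContDiffOn ℝ 1 (derivWithin q S) S := hq.derivWithin hu (by norm_num)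
  have hO : (fun t => derivWithin q S t) =O[𝓝[S] a] fun t => t - a := by
    have := (hd1.differentiableOn (by norm_num) a ha).isBigO_sub
    simpa [h1] using this
  obtain ⟨C, hC⟩ := hO.bound
  obtain ⟨δ, hδ, hB⟩ := Metric.mem_nhdsWithin_iff.1 hC
  refine Asymptotics.IsBigO.of_bound C ?_
  refine Metric.mem_nhdsWithin_iff.2 ⟨δ, hδ, ?_⟩
  rintro t ⟨ht, htS⟩
  -- Mean value inequality on the part of `S` within distance `|t - a|` of `a`, where the derivative
  -- is at most `C |t - a|`.
  have hconv : Convex ℝ (S ∩ Metric.closedBall a |t - a|) := hS.inter (convex_closedBall _ _)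
  have := hconv.norm_image_sub_le_of_norm_hasDerivWithin_le (f := q) (f' := derivWithin q S)
    (C := C * |t - a|) (x := a) (y := t)
    (fun x hx => ((hd x hx.1).hasDerivWithinAt).mono inter_subset_left)
    (fun x hx => ?_) ⟨ha, by simp⟩ ⟨htS, by simp [Real.dist_eq]⟩
  · rw [h0, sub_zero] at this
    change ‖q t‖ ≤ C * ‖(t - a) ^ 2‖
    calc ‖q t‖ ≤ C * |t - a| * ‖t - a‖ := this
      _ = C * ‖(t - a) ^ 2‖ := by rw [norm_pow, Real.norm_eq_abs]; ring
  · have hxa : |x - a| ≤ |t - a| := by simpa [Real.dist_eq] using hx.2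
    have htd : |t - a| < δ := by simpa [Real.dist_eq] using ht
    have h2 : ‖derivWithin q S x‖ ≤ C * ‖x - a‖ :=
      hB ⟨by simpa [Real.dist_eq] using lt_of_le_of_lt hxa htd, hx.1⟩
    rcases eq_or_ne x a with rfl | hne
    · rw [h1, norm_zero]
      rcases eq_or_ne t x with rfl | hne'
      · simp
      · have h3 : ‖derivWithin q S t‖ ≤ C * ‖t - x‖ := hB ⟨by simpa [Real.dist_eq] using htd, htS⟩
        exact (norm_nonneg _).trans h3
    · have hC0 : 0 ≤ C := by
        have : 0 < ‖x - a‖ := norm_pos_iff.2 (sub_ne_zero.2 hne)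
        by_contra hc
        push Not at hc
        have := mul_neg_of_neg_of_pos hc this
        linarith [norm_nonneg (derivWithin q S x)]
      exact h2.trans (mul_le_mul_of_nonneg_left hxa hC0)

/-- Near zero `x log x = O(|x|^(3/4))`, so a quadratic zero gives `O(|t - a|^(3/2))`. Any exponent
strictly between 1/2 and 1 would serve. -/
theorem mul_log_isLittleO_of_sq {l : Filter ℝ} {q : ℝ → ℝ} {a : ℝ} (hl : l ≤ 𝓝 a)
    (hq : q =O[l] fun t => (t - a) ^ 2) :
    (fun t => q t * Real.log (q t)) =o[l] fun t => t - a := by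
  have h0 : Tendsto (fun t => t - a) l (𝓝 0) := by
    have : Tendsto (fun t => t - a) (𝓝 a) (𝓝 (a - a)) := (continuous_id.sub continuous_const).tendsto a
    simpa using this.mono_left hl
  have hq0 : Tendsto q l (𝓝 0) := hq.trans_tendsto (by simpa using h0.pow 2)
  have hb : (fun x : ℝ => x * Real.log x) =O[𝓝 0] fun x => |x| ^ (3 / 4 : ℝ) := by
    refine Asymptotics.IsBigO.of_bound 4 ?_
    filter_upwards [Metric.ball_mem_nhds (0 : ℝ) one_pos] with x hx
    have hx1 : |x| < 1 := by simpa using hx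
    rcases eq_or_ne x 0 with rfl | hne
    · simp
    have hp : 0 < |x| := abs_pos.2 hne
    have := (Real.abs_log_mul_self_rpow_lt |x| (1 / 4) hp hx1.le (by norm_num)).le
    rw [abs_mul, Real.log_abs] at this
    have e : |x| = |x| ^ (1 / 4 : ℝ) * |x| ^ (3 / 4 : ℝ) := by
      rw [← Real.rpow_add hp]; norm_num
    have hnn : 0 ≤ |x| ^ (3 / 4 : ℝ) := by positivity
    have hnn' : 0 ≤ |x| ^ (1 / 4 : ℝ) := by positivity
    rw [abs_of_nonneg hnn'] at this
    rw [norm_mul, Real.norm_eq_abs, Real.norm_eq_abs, Real.norm_eq_abs, abs_of_nonneg hnn]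
    calc |x| * |Real.log x| = (|Real.log x| * |x| ^ (1 / 4 : ℝ)) * |x| ^ (3 / 4 : ℝ) := by
          nth_rewrite 1 [e]; ring
      _ ≤ 4 * |x| ^ (3 / 4 : ℝ) := by
          refine mul_le_mul_of_nonneg_right (this.trans (by norm_num)) hnn
  have h1 : (fun t => q t * Real.log (q t)) =O[l] fun t => |q t| ^ (3 / 4 : ℝ) := hb.comp_tendsto hq0
  have h2 : (fun t => |q t| ^ (3 / 4 : ℝ)) =O[l] fun t => ((t - a) ^ 2) ^ (3 / 4 : ℝ) :=
    (hq.norm_left).rpow (by norm_num) (Eventually.of_forall fun t => by positivity)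
  refine (h1.trans h2).trans_isLittleO ?_
  have e : (fun t => ((t - a) ^ 2) ^ (3 / 4 : ℝ)) = fun t => |t - a| * |t - a| ^ (1 / 2 : ℝ) := by
    funext t
    rcases eq_or_ne t a with rfl | hne
    · norm_num
    have hp : 0 < |t - a| := abs_pos.2 (sub_ne_zero.2 hne)
    rw [← sq_abs, ← Real.rpow_natCast, ← Real.rpow_mul hp.le]
    nth_rewrite 2 [← Real.rpow_one |t - a|]
    rw [← Real.rpow_add hp]; norm_num
  rw [e]
  have h3 : (fun t => |t - a| ^ (1 / 2 : ℝ)) =o[l] fun _ => (1 : ℝ) := by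
    rw [Asymptotics.isLittleO_one_iff]
    have := (h0.abs).rpow_const (p := 1 / 2) (Or.inr (by norm_num))
    simpa using this
  have h4 : (fun t => |t - a|) =O[l] fun t => t - a :=
    (Asymptotics.isBigO_refl _ l).norm_left
  simpa using h4.mul_isLittleO h3

/-- The derivative of `q log q` for a nonnegative `C²` function `q`, also at zeros of `q`. -/
theorem hasDerivWithinAt_mul_log {S : Set ℝ} (hS : Convex ℝ S) (hu : UniqueDiffOn ℝ S) {q : ℝ → ℝ}
    (hq : ContDiffOn ℝ 2 q S) {a : ℝ} (ha : a ∈ S) (h1 : q a = 0 → derivWithin q S a = 0) :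
    HasDerivWithinAt (fun t => q t * Real.log (q t))
      (derivWithin q S a * (Real.log (q a) + 1)) S a := by
  have hd : HasDerivWithinAt q (derivWithin q S a) S a :=
    (hq.differentiableOn (by norm_num) a ha).hasDerivWithinAt
  by_cases h0 : q a = 0
  · rw [h1 h0, zero_mul, hasDerivWithinAt_iff_isLittleO]
    have := mul_log_isLittleO_of_sq nhdsWithin_le_nhds
      (isBigO_sq_of_deriv_zero hS hu hq ha h0 (h1 h0))
    simpa [h0] using this
  · have := hd.mul (hd.log h0)
    refine this.congr_deriv ?_
    rw [mul_div_cancel₀ _ h0]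
    ring

/-- If `q` vanishes at the left endpoint and `q' (1 + |log (q / m)|)` stays bounded, then `q'`
vanishes there as well. -/
theorem deriv_zero_of_mul_log_bounded {b T G : ℝ} (hb : 0 < b) (hbT : b < T) {q m : ℝ → ℝ}
    (hq : ContDiffOn ℝ 2 q (Ico 0 T)) (hm : ContinuousWithinAt m (Ico 0 T) 0) (hm0 : 0 < m 0)
    (h0 : q 0 = 0)
    (hG : ∀ t ∈ Icc 0 b, |derivWithin q (Ico 0 T) t| * (1 + |Real.log (q t / m t)|) ≤ G) :
    derivWithin q (Ico 0 T) 0 = 0 := by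
  have hT : 0 < T := hb.trans hbT
  have h0T : (0 : ℝ) ∈ Ico 0 T := ⟨le_rfl, hT⟩
  have hu : UniqueDiffOn ℝ (Ico 0 T) := uniqueDiffOn_Ico 0 T
  have hd := (hq.differentiableOn (by norm_num) 0 h0T).hasDerivWithinAt
  have hsub : 𝓝[>] (0 : ℝ) ≤ 𝓝[Ico 0 T] 0 := by
    rw [← nhdsWithin_Ioo_eq_nhdsGT hT]
    exact nhdsWithin_mono _ Ioo_subset_Ico_self
  -- If the derivative at 0 is nonzero, `q` is nonzero just to the right of 0 while `q / m` tends to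
  -- 0, so the logarithm blows up against a factor bounded away from 0.
  by_contra hne
  have hcd : ContinuousWithinAt (derivWithin q (Ico 0 T)) (Ico 0 T) 0 :=
    (hq.derivWithin hu (m := 1) (by norm_num)).continuousOn 0 h0T
  have hcd' : Tendsto (fun t => |derivWithin q (Ico 0 T) t|) (𝓝[>] 0)
      (𝓝 |derivWithin q (Ico 0 T) 0|) := (hcd.tendsto.mono_left hsub).abs
  have hq0 : Tendsto q (𝓝[>] 0) (𝓝 0) := by
    have := (hq.continuousOn 0 h0T).tendsto.mono_left hsub
    rwa [h0] at this
  have hqne : ∀ᶠ t in 𝓝[>] (0 : ℝ), q t ≠ 0 := by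
    have h2 := hd.eventually_ne (c := 0) hne
    have h3 : 𝓝[>] (0 : ℝ) ≤ 𝓝[Ico 0 T \ {0}] 0 := by
      rw [← nhdsWithin_Ioo_eq_nhdsGT hT]
      exact nhdsWithin_mono _ fun x hx => ⟨⟨hx.1.le, hx.2⟩, by simpa using hx.1.ne'⟩
    exact h3 h2
  have hmt : Tendsto m (𝓝[>] 0) (𝓝 (m 0)) := hm.tendsto.mono_left hsub
  have hdiv : Tendsto (fun t => q t / m t) (𝓝[>] 0) (𝓝[≠] 0) := by
    refine tendsto_nhdsWithin_iff.2 ⟨?_, ?_⟩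
    · have := hq0.div hmt hm0.ne'
      rwa [zero_div] at this
    filter_upwards [hqne, hmt.eventually (lt_mem_nhds hm0)] with t h1 h2
    exact div_ne_zero h1 h2.ne'
  have hlog : Tendsto (fun t => |Real.log (q t / m t)|) (𝓝[>] 0) atTop :=
    tendsto_abs_atBot_atTop.comp (Real.tendsto_log_nhdsNE_zero.comp hdiv)
  have hprod : Tendsto (fun t => |derivWithin q (Ico 0 T) t| * (1 + |Real.log (q t / m t)|))
      (𝓝[>] 0) atTop :=
    hcd'.pos_mul_atTop (abs_pos.2 hne) (tendsto_atTop_add_const_left _ _ hlog)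
  have hev : ∀ᶠ t in 𝓝[>] (0 : ℝ), t ∈ Icc 0 b := by
    filter_upwards [Ioo_mem_nhdsGT hb] with t ht using ⟨ht.1.le, ht.2.le⟩
  obtain ⟨t, h1, h2⟩ := ((hprod.eventually_gt_atTop G).and hev).exists
  linarith [hG t h2]

/-- A nonnegative function has vanishing derivative at an interior zero. -/
theorem derivWithin_zero_of_interior_zero {S : Set ℝ} {q : ℝ → ℝ} {a : ℝ} (hS : S ∈ 𝓝 a)
    (hpos : ∀ t ∈ S, 0 ≤ q t) (h0 : q a = 0) : derivWithin q S a = 0 := by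
  rw [derivWithin_of_mem_nhds hS]
  refine IsLocalMin.deriv_eq_zero ?_
  filter_upwards [hS] with t ht
  rw [h0]; exact hpos t ht

/-! ### Gronwall on `[0,T)` -/

/-- `(H + ε) e^(-Ct)` has nonpositive derivative in the interior; at the endpoint 0 only continuity
is needed. -/
theorem gronwall_of_derivWithin_le {T C ε : ℝ} {H : ℝ → ℝ}
    (hd : ∀ t ∈ Ico 0 T, DifferentiableWithinAt ℝ H (Ico 0 T) t)
    (hle : ∀ t ∈ Ico 0 T, derivWithin H (Ico 0 T) t ≤ C * (H t + ε)) {t : ℝ} (ht : t ∈ Ico 0 T) :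
    H t + ε ≤ (H 0 + ε) * Real.exp (C * t) := by
  have hanti : AntitoneOn (fun s => (H s + ε) * Real.exp (-(C * s))) (Ico 0 T) := by
    have hD : ∀ s ∈ Ico 0 T, HasDerivWithinAt (fun s => (H s + ε) * Real.exp (-(C * s)))
        (derivWithin H (Ico 0 T) s * Real.exp (-(C * s))
          + (H s + ε) * (Real.exp (-(C * s)) * -(C * 1))) (Ico 0 T) s := fun s hs =>
      ((hd s hs).hasDerivWithinAt.add_const ε).mul
        ((((hasDerivAt_id s).const_mul C).neg.exp).hasDerivWithinAt)
    refine antitoneOn_of_deriv_nonpos (convex_Ico 0 T)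
      (fun s hs => (hD s hs).continuousWithinAt)
      (fun s hs => ((hD s (interior_subset hs)).mono interior_subset).differentiableWithinAt) ?_
    intro s hs
    have hs' := interior_subset hs
    rw [((hD s hs').hasDerivAt (mem_interior_iff_mem_nhds.1 hs)).deriv]
    have := mul_le_mul_of_nonneg_right (hle s hs') (Real.exp_pos (-(C * s))).le
    nlinarith
  have h := hanti ⟨le_rfl, ht.1.trans_lt ht.2⟩ ht ht.1
  simp only [mul_zero, neg_zero, Real.exp_zero, mul_one] at h
  have := mul_le_mul_of_nonneg_right h (Real.exp_pos (C * t)).le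
  rwa [mul_assoc, ← Real.exp_add, neg_add_cancel, Real.exp_zero, mul_one] at this

/-! ### Coordinates -/

theorem eq_sum_smul_single (w : E d) : w = ∑ j, w j • EuclideanSpace.single j (1 : ℝ) := by
  have := (EuclideanSpace.basisFun (Fin d) ℝ).sum_repr w
  simpa using this.symm

theorem clm_apply_eq_sum (L : E d →L[ℝ] ℝ) (w : E d) :
    L w = ∑ j, w j * L (EuclideanSpace.single j 1) := by
  conv_lhs => rw [eq_sum_smul_single w]
  simp [map_sum]

/-! ### Gaussian integrals -/

theorem maxwellian_pos {ρ θ : ℝ} (hρ : 0 < ρ) (hθ : 0 < θ) (u v : E d) :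
    0 < maxwellian ρ u θ v := by
  unfold maxwellian; positivity

theorem maxwellian_zero_density (u v : E d) (θ : ℝ) : maxwellian 0 u θ v = 0 := by
  simp [maxwellian]

theorem continuous_maxwellian (ρ : ℝ) (u : E d) (θ : ℝ) : Continuous (maxwellian ρ u θ) := by
  unfold maxwellian; fun_prop

theorem maxwellian_eq_shift (ρ : ℝ) (u : E d) (θ : ℝ) (v : E d) :
    maxwellian ρ u θ v = maxwellian ρ 0 θ (v - u) := by
  simp [maxwellian]

theorem maxwellian_neg (ρ θ : ℝ) (ξ : E d) : maxwellian ρ 0 θ (-ξ) = maxwellian ρ 0 θ ξ := by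
  simp [maxwellian]

theorem integral_exp_neg_sq {a : ℝ} (ha : 0 < a) :
    ∫ ξ : E d, Real.exp (-(‖ξ‖ ^ 2 / a)) = (Real.pi * a) ^ ((d : ℝ) / 2) := by
  have := GaussianFourier.integral_rexp_neg_mul_sq_norm (V := E d) (inv_pos.2 ha)
  rw [finrank_euclideanSpace_fin, div_inv_eq_mul] at this
  rw [← this]
  congr 1; funext ξ; congr 1; ring

/-- A non-integrable function has integral 0 by convention, but the Gaussian integral is positive.
-/
theorem integrable_exp_neg_sq {a : ℝ} (ha : 0 < a) :
    Integrable fun ξ : E d => Real.exp (-(‖ξ‖ ^ 2 / a)) := by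
  by_contra h
  have h1 := integral_exp_neg_sq (d := d) ha
  rw [integral_undef h] at h1
  have : 0 < (Real.pi * a) ^ ((d : ℝ) / 2) := by positivity
  linarith

/-- Half of the Gaussian exponent is spent on the polynomial: with `y = ‖ξ‖² / (4θ)`, `y³ ≤ 6 e^y`,
and `64 · 6 = 384`. -/
theorem norm_pow_six_mul_exp_le {θ : ℝ} (hθ : 0 < θ) (ξ : E d) :
    ‖ξ‖ ^ 6 * Real.exp (-(‖ξ‖ ^ 2 / (2 * θ))) ≤ 384 * θ ^ 3 * Real.exp (-(‖ξ‖ ^ 2 / (4 * θ))) := by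
  set y := ‖ξ‖ ^ 2 / (4 * θ) with hy
  have hy0 : 0 ≤ y := by positivity
  have h1 := Real.pow_div_factorial_le_exp y hy0 3
  have h2 : ‖ξ‖ ^ 6 = 64 * θ ^ 3 * y ^ 3 := by rw [hy]; field_simp; ring
  have h3 : -(‖ξ‖ ^ 2 / (2 * θ)) = -y + -y := by rw [hy]; field_simp; ring
  have h4 : y ^ 3 ≤ 6 * Real.exp y := by
    have : ((3 : ℕ).factorial : ℝ) = 6 := by norm_num [Nat.factorial]
    rw [this, div_le_iff₀ (by norm_num)] at h1; linarith
  rw [h2, h3, Real.exp_add]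
  have h5 : Real.exp y * Real.exp (-y) = 1 := by rw [← Real.exp_add]; simp
  calc 64 * θ ^ 3 * y ^ 3 * (Real.exp (-y) * Real.exp (-y))
      ≤ 64 * θ ^ 3 * (6 * Real.exp y) * (Real.exp (-y) * Real.exp (-y)) := by gcongr
    _ = 384 * θ ^ 3 * ((Real.exp y * Real.exp (-y)) * Real.exp (-y)) := by ring
    _ = _ := by rw [h5, one_mul]

theorem maxwellian_nonneg {ρ θ : ℝ} (hρ : 0 ≤ ρ) (hθ : 0 < θ) (u v : E d) :
    0 ≤ maxwellian ρ u θ v := by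
  unfold maxwellian; positivity

theorem integrable_maxwellian (ρ : ℝ) {θ : ℝ} (hθ : 0 < θ) (u : E d) :
    Integrable (maxwellian ρ u θ) := by
  have : Integrable (maxwellian ρ (0 : E d) θ) := by
    have := (integrable_exp_neg_sq (d := d) (by positivity : 0 < 2 * θ)).const_mul
      (ρ / (2 * Real.pi * θ) ^ ((d : ℝ) / 2))
    unfold maxwellian
    simpa only [sub_zero] using this
  convert this.comp_sub_right u using 1
  funext v; exact maxwellian_eq_shift _ _ _ _

theorem integral_maxwellian (ρ : ℝ) {θ : ℝ} (hθ : 0 < θ) (u : E d) :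
    ∫ v, maxwellian ρ u θ v = ρ := by
  simp_rw [maxwellian_eq_shift ρ u]
  rw [integral_sub_right_eq_self (fun v => maxwellian ρ 0 θ v) u]
  simp only [maxwellian, sub_zero]
  rw [integral_const_mul, integral_exp_neg_sq (by positivity),
    show Real.pi * (2 * θ) = 2 * Real.pi * θ by ring]
  have : (0 : ℝ) < (2 * Real.pi * θ) ^ ((d : ℝ) / 2) := by positivity
  field_simp

theorem integrable_maxwellian_mul_pow_six (ρ : ℝ) {θ : ℝ} (hθ : 0 < θ) :
    Integrable fun ξ : E d => maxwellian ρ 0 θ ξ * ‖ξ‖ ^ 6 := by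
  have h4 : Integrable fun ξ : E d => |ρ / (2 * Real.pi * θ) ^ ((d : ℝ) / 2)| *
      (384 * θ ^ 3 * Real.exp (-(‖ξ‖ ^ 2 / (4 * θ)))) :=
    ((integrable_exp_neg_sq (by positivity)).const_mul _).const_mul _
  refine h4.mono' ((continuous_maxwellian _ _ _).mul (by fun_prop)).aestronglyMeasurable
    (Eventually.of_forall fun ξ => ?_)
  have := norm_pow_six_mul_exp_le hθ ξ
  simp only [maxwellian, sub_zero]
  rw [mul_assoc, norm_mul, Real.norm_eq_abs]
  refine mul_le_mul_of_nonneg_left ?_ (abs_nonneg _)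
  rw [Real.norm_of_nonneg (by positivity), mul_comm]
  exact this

/-- Continuous functions of growth at most `‖ξ‖ ^ 6` are integrable against a Maxwellian. -/
theorem integrable_maxwellian_mul (ρ : ℝ) {θ K : ℝ} (hθ : 0 < θ) (u : E d) {g : E d → ℝ}
    (hg : Continuous g) (hgK : ∀ v, |g v| ≤ K * (1 + ‖v - u‖ ^ 6)) :
    Integrable fun v : E d => maxwellian ρ u θ v * g v := by
  have h1 : Integrable fun ξ : E d => K * (|maxwellian ρ 0 θ ξ| + |maxwellian ρ 0 θ ξ * ‖ξ‖ ^ 6|) :=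
    ((integrable_maxwellian ρ hθ 0).abs.add (integrable_maxwellian_mul_pow_six ρ hθ).abs).const_mul K
  refine (h1.comp_sub_right u).mono' ((continuous_maxwellian _ _ _).mul hg).aestronglyMeasurable
    (Eventually.of_forall fun v => ?_)
  rw [norm_mul, Real.norm_eq_abs, Real.norm_eq_abs, maxwellian_eq_shift]
  calc |maxwellian ρ 0 θ (v - u)| * |g v|
      ≤ |maxwellian ρ 0 θ (v - u)| * (K * (1 + ‖v - u‖ ^ 6)) :=
        mul_le_mul_of_nonneg_left (hgK v) (abs_nonneg _)
    _ = _ := by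
        rw [abs_mul, abs_of_nonneg (by positivity : 0 ≤ ‖v - u‖ ^ 6)]; ring

theorem integral_maxwellian_mul_odd (ρ θ : ℝ) {g : E d → ℝ} (hg : ∀ ξ, g (-ξ) = -g ξ) :
    ∫ ξ, maxwellian ρ 0 θ ξ * g ξ = 0 := by
  have h := integral_neg_eq_self (fun ξ : E d => maxwellian ρ 0 θ ξ * g ξ) volume
  simp only [maxwellian_neg, hg, mul_neg, integral_neg] at h
  linarith

theorem pow_le_one_add_pow_six {r : ℝ} (hr : 0 ≤ r) {n : ℕ} (hn : n ≤ 6) : r ^ n ≤ 1 + r ^ 6 := by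
  rcases le_total r 1 with h | h
  · have := pow_le_one₀ hr h (n := n)
    have : 0 ≤ r ^ 6 := by positivity
    linarith
  · have := pow_le_pow_right₀ h hn
    linarith

theorem hasFDerivAt_maxwellian (ρ θ : ℝ) (ξ : E d) :
    HasFDerivAt (maxwellian ρ 0 θ) (-(maxwellian ρ 0 θ ξ / θ) • innerSL ℝ ξ) ξ := by
  have h1 : HasFDerivAt (fun ξ : E d => ‖ξ‖ ^ 2) (2 • innerSL ℝ ξ) ξ :=
    (hasStrictFDerivAt_norm_sq ξ).hasFDerivAt
  have h2 := (((h1.mul_const (2 * θ)⁻¹).neg).exp).const_mul (ρ / (2 * Real.pi * θ) ^ ((d : ℝ) / 2))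
  have e : maxwellian ρ (0 : E d) θ = fun ξ => ρ / (2 * Real.pi * θ) ^ ((d : ℝ) / 2) *
      Real.exp (-(‖ξ‖ ^ 2 * (2 * θ)⁻¹)) := by
    funext ξ; simp [maxwellian, div_eq_mul_inv]
  rw [e]
  refine h2.congr_fderiv ?_
  ext w
  have h3 : maxwellian ρ (0 : E d) θ ξ = ρ / (2 * Real.pi * θ) ^ ((d : ℝ) / 2) *
      Real.exp (-(‖ξ‖ ^ 2 * (2 * θ)⁻¹)) := congrFun e ξ
  rw [← e, h3]
  simp only [smul_apply, neg_apply, smul_eq_mul, nsmul_eq_mul, mul_inv, innerSL_apply_apply,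
    Pi.neg_apply]
  generalize (inner ℝ ξ w : ℝ) = z
  push_cast
  ring

/-- Integration by parts: `∂_i M = -(ξ_i / θ) M`, so one factor `ξ_i` is traded for `θ ∂_i ξ_j`. -/
theorem integral_maxwellian_coord_mul_coord (ρ : ℝ) {θ : ℝ} (hθ : 0 < θ) (i j : Fin d) :
    ∫ ξ : E d, maxwellian ρ 0 θ ξ * (ξ i * ξ j) = if i = j then ρ * θ else 0 := by
  have hc : ∀ (ξ : E d) (k : Fin d), |ξ k| ≤ ‖ξ‖ := fun ξ k => by
    simpa using PiLp.norm_apply_le ξ k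
  have hfd : ∀ x, fderiv ℝ (maxwellian ρ (0 : E d) θ) x (EuclideanSpace.single i 1)
      = -(1 / θ) * (maxwellian ρ 0 θ x * x i) := fun x => by
    rw [(hasFDerivAt_maxwellian ρ θ x).fderiv]
    simp [EuclideanSpace.inner_single_right]
    ring
  have hfp : ∀ x : E d, fderiv ℝ (fun ξ : E d => ξ j) x (EuclideanSpace.single i 1)
      = if i = j then 1 else 0 := fun x => by
    have : HasFDerivAt (fun ξ : E d => ξ j) (EuclideanSpace.proj j : E d →L[ℝ] ℝ) x :=
      (EuclideanSpace.proj j : E d →L[ℝ] ℝ).hasFDerivAt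
    rw [this.fderiv]
    simp [eq_comm]
  have I1 : Integrable fun ξ : E d => maxwellian ρ 0 θ ξ * (ξ i * ξ j) :=
    integrable_maxwellian_mul (K := 1) ρ hθ 0 (by fun_prop) fun v => by
      rw [abs_mul, sub_zero, one_mul]
      calc |v i| * |v j| ≤ ‖v‖ * ‖v‖ := mul_le_mul (hc v i) (hc v j) (abs_nonneg _) (norm_nonneg _)
        _ = ‖v‖ ^ 2 := by ring
        _ ≤ _ := pow_le_one_add_pow_six (norm_nonneg _) (by norm_num)
  have I2 : Integrable fun ξ : E d => maxwellian ρ 0 θ ξ * ξ j :=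
    integrable_maxwellian_mul (K := 1) ρ hθ 0 (by fun_prop) fun v => by
      rw [sub_zero, one_mul]
      calc |v j| ≤ ‖v‖ ^ 1 := by simpa using hc v j
        _ ≤ _ := pow_le_one_add_pow_six (norm_nonneg _) (by norm_num)
  have key := integral_mul_fderiv_eq_neg_fderiv_mul_of_integrable (μ := (volume : Measure (E d)))
    (f := maxwellian ρ (0 : E d) θ) (g := fun ξ : E d => ξ j) (v := EuclideanSpace.single i 1)
    (by
      simp only [hfd]
      exact (I1.const_mul (-(1 / θ))).congr (.of_forall fun ξ => by simp only; ring))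
    (by simp only [hfp]; exact (integrable_maxwellian ρ hθ 0).mul_const _) I2
    (fun x _ => (hasFDerivAt_maxwellian ρ θ x).differentiableAt)
    (fun x _ => (EuclideanSpace.proj j : E d →L[ℝ] ℝ).differentiableAt)
  simp only [hfd, hfp] at key
  rw [integral_mul_const, integral_maxwellian ρ hθ] at key
  have e : (∫ x : E d, -(1 / θ) * (maxwellian ρ 0 θ x * x i) * x j)
      = -(1 / θ) * ∫ ξ : E d, maxwellian ρ 0 θ ξ * (ξ i * ξ j) := by
    rw [← integral_const_mul]; congr 1; funext ξ; ring
  rw [e] at key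
  have : ∫ ξ : E d, maxwellian ρ 0 θ ξ * (ξ i * ξ j) = θ * (ρ * if i = j then 1 else 0) := by
    rw [key]; field_simp
  rw [this]; split_ifs <;> ring

/-- Second moments: `∫ M(ξ) ⟪ξ, Bξ⟫ = ρ θ tr B`. -/
theorem integral_maxwellian_inner_clm (ρ : ℝ) {θ : ℝ} (hθ : 0 < θ) (B : E d →L[ℝ] E d) :
    ∫ ξ : E d, maxwellian ρ 0 θ ξ * inner ℝ ξ (B ξ)
      = ρ * θ * ∑ j, B (EuclideanSpace.single j 1) j := by
  have hc : ∀ (ξ : E d) (k : Fin d), |ξ k| ≤ ‖ξ‖ := fun ξ k => by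
    simpa using PiLp.norm_apply_le ξ k
  have hB : ∀ ξ : E d, inner ℝ ξ (B ξ)
      = ∑ i, ∑ j, (B (EuclideanSpace.single j 1) i) * (ξ i * ξ j) := fun ξ => by
    have h2 : B ξ = ∑ j, ξ j • B (EuclideanSpace.single j (1 : ℝ)) := by
      conv_lhs => rw [eq_sum_smul_single ξ]
      simp [map_sum]
    rw [PiLp.inner_apply]
    refine Finset.sum_congr rfl fun i _ => ?_
    rw [h2]
    simp [Finset.sum_mul]
    refine Finset.sum_congr rfl fun j _ => by ring
  have I1 : ∀ i j : Fin d, Integrable fun ξ : E d => maxwellian ρ 0 θ ξ * (ξ i * ξ j) := fun i j =>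
    integrable_maxwellian_mul (K := 1) ρ hθ 0 (by fun_prop) fun v => by
      rw [abs_mul, sub_zero, one_mul]
      calc |v i| * |v j| ≤ ‖v‖ * ‖v‖ := mul_le_mul (hc v i) (hc v j) (abs_nonneg _) (norm_nonneg _)
        _ = ‖v‖ ^ 2 := by ring
        _ ≤ _ := pow_le_one_add_pow_six (norm_nonneg _) (by norm_num)
  simp_rw [hB, Finset.mul_sum]
  rw [integral_finsetSum _ fun i _ => integrable_finsetSum _ fun j _ => by
    exact ((I1 i j).const_mul (B (EuclideanSpace.single j 1) i)).congr
      (.of_forall fun ξ => by simp only; ring)]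
  refine Finset.sum_congr rfl fun i _ => ?_
  rw [integral_finsetSum _ fun j _ => by
    exact ((I1 i j).const_mul (B (EuclideanSpace.single j 1) i)).congr
      (.of_forall fun ξ => by simp only; ring)]
  have : ∀ j, ∫ ξ : E d, maxwellian ρ 0 θ ξ * ((B (EuclideanSpace.single j 1)) i * (ξ i * ξ j))
      = (B (EuclideanSpace.single j 1)) i * if i = j then ρ * θ else 0 := fun j => by
    rw [← integral_maxwellian_coord_mul_coord ρ hθ i j, ← integral_const_mul]
    congr 1; funext ξ; ring
  simp_rw [this]
  simp
  ring

theorem integral_maxwellian_norm_sq (ρ : ℝ) {θ : ℝ} (hθ : 0 < θ) :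
    ∫ ξ : E d, maxwellian ρ 0 θ ξ * ‖ξ‖ ^ 2 = d * (ρ * θ) := by
  have := integral_maxwellian_inner_clm ρ hθ (ContinuousLinearMap.id ℝ (E d))
  simp at this
  rw [this]; ring

/-- The rank-one case `B ξ = (L ξ) w`, whose trace is `L w`. -/
theorem integral_maxwellian_inner_mul (ρ : ℝ) {θ : ℝ} (hθ : 0 < θ) (w : E d) (L : E d →L[ℝ] ℝ) :
    ∫ ξ : E d, maxwellian ρ 0 θ ξ * (inner ℝ ξ w * L ξ) = ρ * θ * L w := by
  have := integral_maxwellian_inner_clm ρ hθ (L.smulRight w)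
  have h2 : L w = ∑ j, L (EuclideanSpace.single j 1) * w j := by
    simp_rw [clm_apply_eq_sum L w, mul_comm]
  rw [h2]
  simp [inner_smul_right] at this
  rw [← this]
  congr 1; funext ξ; ring

/-- Quadratic moments of a Maxwellian. -/
theorem integral_maxwellian_quadratic (ρ : ℝ) {θ : ℝ} (hθ : 0 < θ) (u b : E d) (a c : ℝ) :
    Integrable (fun v => maxwellian ρ u θ v * (a + inner ℝ b (v - u) + c * ‖v - u‖ ^ 2)) ∧
    ∫ v, maxwellian ρ u θ v * (a + inner ℝ b (v - u) + c * ‖v - u‖ ^ 2)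
      = ρ * (a + c * (d * θ)) := by
  have J0 := integrable_maxwellian ρ hθ (0 : E d)
  have J1 : Integrable fun ξ : E d => maxwellian ρ 0 θ ξ * inner ℝ b ξ :=
    integrable_maxwellian_mul (K := ‖b‖) ρ hθ 0 (by fun_prop) fun v => by
      rw [sub_zero]
      refine (abs_real_inner_le_norm _ _).trans (mul_le_mul_of_nonneg_left ?_ (norm_nonneg _))
      simpa using pow_le_one_add_pow_six (norm_nonneg v) (n := 1) (by norm_num)
  have J2 : Integrable fun ξ : E d => maxwellian ρ 0 θ ξ * ‖ξ‖ ^ 2 :=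
    integrable_maxwellian_mul (K := 1) ρ hθ 0 (by fun_prop) fun v => by
      rw [sub_zero, one_mul, abs_of_nonneg (by positivity)]
      exact pow_le_one_add_pow_six (norm_nonneg v) (by norm_num)
  have e : (fun ξ : E d => maxwellian ρ 0 θ ξ * (a + inner ℝ b ξ + c * ‖ξ‖ ^ 2))
      = fun ξ => maxwellian ρ 0 θ ξ * a + maxwellian ρ 0 θ ξ * inner ℝ b ξ
        + c * (maxwellian ρ 0 θ ξ * ‖ξ‖ ^ 2) := by funext ξ; ring
  have hI : Integrable fun ξ : E d => maxwellian ρ 0 θ ξ * (a + inner ℝ b ξ + c * ‖ξ‖ ^ 2) := by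
    rw [e]; exact ((J0.mul_const a).add J1).add (J2.const_mul c)
  have J01 : Integrable fun ξ : E d => maxwellian ρ 0 θ ξ * a + maxwellian ρ 0 θ ξ * inner ℝ b ξ :=
    (J0.mul_const a).add J1
  simp_rw [maxwellian_eq_shift ρ u]
  refine ⟨hI.comp_sub_right u, ?_⟩
  rw [integral_sub_right_eq_self
    (fun ξ : E d => maxwellian ρ 0 θ ξ * (a + inner ℝ b ξ + c * ‖ξ‖ ^ 2)) u, e,
    integral_add J01 (J2.const_mul c), integral_add (J0.mul_const a) J1,
    integral_mul_const, integral_const_mul, integral_maxwellian ρ hθ,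
    integral_maxwellian_norm_sq ρ hθ, integral_maxwellian_mul_odd ρ θ (fun ξ => inner_neg_right _ _)]
  ring

/-- The bound is linear in `ρ` and otherwise uniform, so it can be integrated in `x` using only the
total mass. The factor 32 comes from splitting `(‖v - u‖ + U)^6`, and `2^(d/2)` is the ratio of the
normalizations of the Gaussians with exponents `‖ξ‖²/(4θ)` and `‖ξ‖²/(2θ)`. -/
theorem integral_maxwellian_pow_six_le {ρ θ Θ U : ℝ} (hρ : 0 ≤ ρ) (hθ : 0 < θ) (hΘ : θ ≤ Θ)
    {u : E d} (hu : ‖u‖ ≤ U) :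
    Integrable (fun v => maxwellian ρ u θ v * ‖v‖ ^ 6) ∧
    ∫ v, maxwellian ρ u θ v * ‖v‖ ^ 6
      ≤ ρ * (32 * (384 * Θ ^ 3 * 2 ^ ((d : ℝ) / 2) + U ^ 6)) := by
  have hU : 0 ≤ U := (norm_nonneg u).trans hu
  have hpt : ∀ v : E d, ‖v‖ ^ 6 ≤ 32 * (‖v - u‖ ^ 6 + U ^ 6) := fun v => by
    have h1 : ‖v‖ ≤ ‖v - u‖ + U := by
      have := norm_add_le (v - u) u
      rw [sub_add_cancel] at this; linarith
    calc ‖v‖ ^ 6 ≤ (‖v - u‖ + U) ^ 6 := pow_le_pow_left₀ (norm_nonneg _) h1 6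
      _ ≤ 2 ^ (6 - 1) * (‖v - u‖ ^ 6 + U ^ 6) := add_pow_le (norm_nonneg _) hU 6
      _ = _ := by norm_num
  have hI : Integrable (fun v => maxwellian ρ u θ v * ‖v‖ ^ 6) :=
    integrable_maxwellian_mul (K := 32 * (1 + U ^ 6)) ρ hθ u (by fun_prop) fun v => by
      rw [abs_of_nonneg (by positivity)]
      refine (hpt v).trans ?_
      have h1 : 0 ≤ ‖v - u‖ ^ 6 := by positivity
      have h2 : 0 ≤ U ^ 6 := by positivity
      nlinarith [mul_nonneg h1 h2]
  refine ⟨hI, ?_⟩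
  have J6 := integrable_maxwellian_mul_pow_six (d := d) ρ hθ
  have J6s : Integrable fun v => maxwellian ρ u θ v * ‖v - u‖ ^ 6 := by
    simp_rw [maxwellian_eq_shift ρ u]; exact J6.comp_sub_right u
  have h6 : ∫ v, maxwellian ρ u θ v * ‖v - u‖ ^ 6 ≤ ρ * (384 * Θ ^ 3 * 2 ^ ((d : ℝ) / 2)) := by
    simp_rw [maxwellian_eq_shift ρ u]
    rw [integral_sub_right_eq_self (fun ξ : E d => maxwellian ρ 0 θ ξ * ‖ξ‖ ^ 6) u]
    have hc : 0 < (2 * Real.pi * θ) ^ ((d : ℝ) / 2) := by positivity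
    calc ∫ ξ : E d, maxwellian ρ 0 θ ξ * ‖ξ‖ ^ 6
        ≤ ∫ ξ : E d, ρ / (2 * Real.pi * θ) ^ ((d : ℝ) / 2) * (384 * θ ^ 3) *
            Real.exp (-(‖ξ‖ ^ 2 / (4 * θ))) := by
          refine integral_mono J6 ((integrable_exp_neg_sq (by positivity)).const_mul _) fun ξ => ?_
          simp only [maxwellian, sub_zero]
          rw [mul_assoc, mul_assoc (ρ / (2 * Real.pi * θ) ^ ((d : ℝ) / 2))]
          have hc' : 0 ≤ ρ / (2 * Real.pi * θ) ^ ((d : ℝ) / 2) := by positivity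
          refine mul_le_mul_of_nonneg_left ?_ hc'
          rw [mul_comm]; exact norm_pow_six_mul_exp_le hθ ξ
      _ = ρ * (384 * θ ^ 3 * 2 ^ ((d : ℝ) / 2)) := by
          have h2c : (2 * (2 * Real.pi * θ)) ^ ((d : ℝ) / 2)
              = 2 ^ ((d : ℝ) / 2) * (2 * Real.pi * θ) ^ ((d : ℝ) / 2) :=
            Real.mul_rpow (by norm_num) (by positivity)
          rw [integral_const_mul, integral_exp_neg_sq (by positivity),
            show Real.pi * (4 * θ) = 2 * (2 * Real.pi * θ) by ring, h2c]
          generalize (2 * Real.pi * θ) ^ ((d : ℝ) / 2) = c at hc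
          field_simp
      _ ≤ _ := by gcongr
  calc ∫ v, maxwellian ρ u θ v * ‖v‖ ^ 6
      ≤ ∫ v, (32 * (maxwellian ρ u θ v * ‖v - u‖ ^ 6) + 32 * U ^ 6 * maxwellian ρ u θ v) := by
        refine integral_mono hI ((J6s.const_mul _).add ((integrable_maxwellian ρ hθ u).const_mul _))
          fun v => ?_
        have := mul_le_mul_of_nonneg_left (hpt v) (maxwellian_nonneg hρ hθ u v)
        simp only
        linarith
    _ = 32 * (∫ v, maxwellian ρ u θ v * ‖v - u‖ ^ 6) + 32 * U ^ 6 * ρ := by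
        rw [integral_add (J6s.const_mul _) ((integrable_maxwellian ρ hθ u).const_mul _),
          integral_const_mul, integral_const_mul, integral_maxwellian ρ hθ]
    _ ≤ _ := by linarith

/-! ### Moments of a density at a fixed position -/

section Moments

variable {F : E d → E d → ℝ} {x : E d}

theorem integrable_slice (hc : Continuous (F x)) (h0 : ∀ v, 0 ≤ F x v)
    (hF : Integrable fun v => (1 + ‖v‖ ^ 2) * F x v) : Integrable (F x) := by
  refine hF.mono' hc.aestronglyMeasurable (Eventually.of_forall fun v => ?_)
  rw [Real.norm_of_nonneg (h0 v)]
  nlinarith [mul_nonneg (sq_nonneg ‖v‖) (h0 v)]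

theorem integrable_slice_sq (hc : Continuous (F x)) (h0 : ∀ v, 0 ≤ F x v)
    (hF : Integrable fun v => (1 + ‖v‖ ^ 2) * F x v) : Integrable fun v => F x v * ‖v‖ ^ 2 := by
  refine (hF.sub (integrable_slice hc h0 hF)).congr (.of_forall fun v => ?_)
  simp only [Pi.sub_apply]; ring

theorem integrable_slice_smul (hc : Continuous (F x)) (h0 : ∀ v, 0 ≤ F x v)
    (hF : Integrable fun v => (1 + ‖v‖ ^ 2) * F x v) : Integrable fun v => F x v • v := by
  refine hF.mono' (hc.smul continuous_id).aestronglyMeasurable (Eventually.of_forall fun v => ?_)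
  rw [norm_smul, Real.norm_of_nonneg (h0 v), mul_comm]
  exact mul_le_mul_of_nonneg_right (by nlinarith [sq_nonneg (‖v‖ - 1)]) (h0 v)

theorem integral_slice_inner (hc : Continuous (F x)) (h0 : ∀ v, 0 ≤ F x v)
    (hF : Integrable fun v => (1 + ‖v‖ ^ 2) * F x v) (hρ : 0 < density F x) (b : E d) :
    Integrable (fun v => F x v * inner ℝ b (v - meanVelocity F x)) ∧
    ∫ v, F x v * inner ℝ b (v - meanVelocity F x) = 0 := by
  have I0 := integrable_slice hc h0 hF
  have I1 := integrable_slice_smul hc h0 hF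
  have e : (fun v => F x v * inner ℝ b (v - meanVelocity F x))
      = fun v => inner ℝ b (F x v • v) - inner ℝ b (meanVelocity F x) * F x v := by
    funext v; rw [inner_sub_right, real_inner_smul_right]; ring
  have I2 : Integrable fun v => (inner ℝ b (F x v • v) : ℝ) := I1.const_inner b
  rw [e]
  refine ⟨I2.sub (I0.const_mul _), ?_⟩
  rw [integral_sub I2 (I0.const_mul _), integral_const_mul, integral_inner I1]
  have : meanVelocity F x = (density F x)⁻¹ • ∫ v, F x v • v := by simp [meanVelocity, hρ]
  rw [this, real_inner_smul_right]
  change _ - _ * density F x = 0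
  field_simp
  ring

/-- The quadratic moments of `F` at `x`, in terms of its hydrodynamic fields. -/
theorem integral_slice_quadratic (hd : 1 ≤ d) (hc : Continuous (F x)) (h0 : ∀ v, 0 ≤ F x v)
    (hF : Integrable fun v => (1 + ‖v‖ ^ 2) * F x v) (hρ : 0 < density F x) (b : E d) (a c : ℝ) :
    Integrable (fun v => F x v * (a + inner ℝ b (v - meanVelocity F x)
      + c * ‖v - meanVelocity F x‖ ^ 2)) ∧
    ∫ v, F x v * (a + inner ℝ b (v - meanVelocity F x) + c * ‖v - meanVelocity F x‖ ^ 2)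
      = density F x * (a + c * (d * temperature F x)) := by
  set m := meanVelocity F x with hm
  have I0 := integrable_slice hc h0 hF
  obtain ⟨I1, E1⟩ := integral_slice_inner hc h0 hF hρ b
  obtain ⟨I1', -⟩ := integral_slice_inner hc h0 hF hρ m
  rw [← hm] at I1 I1' E1
  have I2 : Integrable fun v => ‖v - m‖ ^ 2 * F x v := by
    refine ((integrable_slice_sq hc h0 hF).sub ((I1'.const_mul 2).add
      (I0.const_mul (‖m‖ ^ 2)))).congr (.of_forall fun v => ?_)
    simp only [Pi.sub_apply, Pi.add_apply]
    have : ‖v‖ ^ 2 = ‖v - m‖ ^ 2 + 2 * inner ℝ m (v - m) + ‖m‖ ^ 2 := by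
      have := norm_add_sq_real (v - m) m
      rw [sub_add_cancel, real_inner_comm] at this
      linarith
    rw [this]; ring
  have E2 : ∫ v, ‖v - m‖ ^ 2 * F x v = density F x * (d * temperature F x) := by
    have : temperature F x = ((d : ℝ) * density F x)⁻¹ * ∫ v, ‖v - m‖ ^ 2 * F x v := by
      simp [temperature, hρ, hm]
    rw [this]
    have : (d : ℝ) ≠ 0 := by positivity
    field_simp
  have e : (fun v => F x v * (a + inner ℝ b (v - m) + c * ‖v - m‖ ^ 2))
      = fun v => F x v * a + F x v * inner ℝ b (v - m) + c * (‖v - m‖ ^ 2 * F x v) := by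
    funext v; ring
  have J : Integrable fun v => F x v * a + F x v * inner ℝ b (v - m) := (I0.mul_const a).add I1
  rw [e]
  refine ⟨J.add (I2.const_mul c), ?_⟩
  rw [integral_add J (I2.const_mul c), integral_add (I0.mul_const a) I1, E1, integral_const_mul, E2,
    integral_mul_const]
  change density F x * a + 0 + _ = _
  ring

theorem slice_ae_zero_of_density_nonpos (hc : Continuous (F x)) (h0 : ∀ v, 0 ≤ F x v)
    (hF : Integrable fun v => (1 + ‖v‖ ^ 2) * F x v) (hρ : ¬ 0 < density F x) :
    density F x = 0 ∧ F x =ᵐ[volume] 0 := by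
  have h1 : 0 ≤ density F x := integral_nonneg h0
  have h2 : density F x = 0 := le_antisymm (not_lt.1 hρ) h1
  exact ⟨h2, (integral_eq_zero_iff_of_nonneg h0 (integrable_slice hc h0 hF)).1 h2⟩

end Moments

/-! ### The logarithm of a Maxwellian -/

theorem log_maxwellian {ρ θ : ℝ} (hρ : 0 < ρ) (hθ : 0 < θ) (u v : E d) :
    Real.log (maxwellian ρ u θ v)
      = Real.log ρ - d / 2 * Real.log (2 * Real.pi * θ) - ‖v - u‖ ^ 2 / (2 * θ) := by
  unfold maxwellian
  have h1 : 0 < (2 * Real.pi * θ) ^ ((d : ℝ) / 2) := by positivity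
  rw [Real.log_mul (by positivity) (Real.exp_pos _).ne', Real.log_exp,
    Real.log_div hρ.ne' h1.ne', Real.log_rpow (by positivity)]
  ring

/-- The quadratic is centred at `u₁`, so its linear term drops out against any density with mean
velocity `u₁`. -/
theorem log_maxwellian_div {ρ₁ ρ₂ θ₁ θ₂ : ℝ} (hρ₁ : 0 < ρ₁) (hρ₂ : 0 < ρ₂) (hθ₁ : 0 < θ₁)
    (hθ₂ : 0 < θ₂) (u₁ u₂ v : E d) :
    Real.log (maxwellian ρ₁ u₁ θ₁ v / maxwellian ρ₂ u₂ θ₂ v)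
      = (Real.log (ρ₁ / ρ₂) - d / 2 * Real.log (θ₁ / θ₂) + ‖u₁ - u₂‖ ^ 2 / (2 * θ₂))
        + inner ℝ ((1 / θ₂) • (u₁ - u₂)) (v - u₁)
        + (1 / (2 * θ₂) - 1 / (2 * θ₁)) * ‖v - u₁‖ ^ 2 := by
  rw [Real.log_div (maxwellian_pos hρ₁ hθ₁ _ _).ne' (maxwellian_pos hρ₂ hθ₂ _ _).ne',
    log_maxwellian hρ₁ hθ₁, log_maxwellian hρ₂ hθ₂, Real.log_div hρ₁.ne' hρ₂.ne',
    Real.log_div hθ₁.ne' hθ₂.ne', Real.log_mul (by positivity) hθ₁.ne',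
    Real.log_mul (by positivity) hθ₂.ne', real_inner_smul_left]
  have : ‖v - u₂‖ ^ 2 = ‖v - u₁‖ ^ 2 + 2 * inner ℝ (u₁ - u₂) (v - u₁) + ‖u₁ - u₂‖ ^ 2 := by
    have := norm_add_sq_real (v - u₁) (u₁ - u₂)
    rw [sub_add_sub_cancel, real_inner_comm] at this
    linarith
  rw [this]
  field_simp
  ring

/-! ### The transport polynomial -/

/-- The trace of a linear map on `ℝ^d`. -/
noncomputable def divergence (B : E d →L[ℝ] E d) : ℝ := ∑ j, B (EuclideanSpace.single j 1) j

/-- `(∂_t + v·∇) log M` as a polynomial in the relative velocity `c = v - u`, for `B = ∇u`,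
`ℓ = ∇ log θ`. -/
noncomputable def transportPoly (θ : ℝ) (B : E d →L[ℝ] E d) (ℓ : E d →L[ℝ] ℝ) (c : E d) : ℝ :=
  inner ℝ c (B c) / θ - ‖c‖ ^ 2 * divergence B / (d * θ)
    + ℓ c * (‖c‖ ^ 2 / (2 * θ) - (d + 2) / 2)

theorem continuous_transportPoly (θ : ℝ) (B : E d →L[ℝ] E d) (ℓ : E d →L[ℝ] ℝ) :
    Continuous (transportPoly θ B ℓ) := by
  unfold transportPoly; fun_prop

theorem abs_divergence_le (B : E d →L[ℝ] E d) : |divergence B| ≤ d * ‖B‖ := by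
  unfold divergence
  refine (Finset.abs_sum_le_sum_abs _ _).trans ?_
  have : ∀ j ∈ Finset.univ, |B (EuclideanSpace.single j 1) j| ≤ ‖B‖ := fun j _ => by
    have h1 : |B (EuclideanSpace.single j 1) j| ≤ ‖B (EuclideanSpace.single j 1)‖ := by
      simpa using PiLp.norm_apply_le (B (EuclideanSpace.single j 1)) j
    have h2 := B.le_opNorm (EuclideanSpace.single j 1)
    simp at h2
    exact h1.trans h2
  simpa using Finset.sum_le_card_nsmul _ _ _ this

section TransportPoly

variable {θ θlo k₁ k₂ : ℝ} {B : E d →L[ℝ] E d} {ℓ : E d →L[ℝ] ℝ}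

theorem abs_inner_clm_div_le (hθlo : 0 < θlo) (hθ : θlo ≤ θ) (hB : ‖B‖ ≤ k₁) (c : E d) :
    |inner ℝ c (B c) / θ| ≤ k₁ / θlo * ‖c‖ ^ 2 := by
  have hθ0 : 0 < θ := hθlo.trans_le hθ
  have hk : 0 ≤ k₁ := (norm_nonneg B).trans hB
  rw [abs_div, abs_of_pos hθ0]
  have h1 : |inner ℝ c (B c)| ≤ k₁ * ‖c‖ ^ 2 := by
    calc |inner ℝ c (B c)| ≤ ‖c‖ * ‖B c‖ := abs_real_inner_le_norm _ _
      _ ≤ ‖c‖ * (k₁ * ‖c‖) := by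
        gcongr; exact (B.le_opNorm c).trans (by gcongr)
      _ = _ := by ring
  calc |inner ℝ c (B c)| / θ ≤ (k₁ * ‖c‖ ^ 2) / θlo := by gcongr
    _ = _ := by ring

theorem abs_norm_sq_mul_divergence_div_le (hd : 1 ≤ d) (hθlo : 0 < θlo) (hθ : θlo ≤ θ)
    (hB : ‖B‖ ≤ k₁) (c : E d) :
    |‖c‖ ^ 2 * divergence B / (d * θ)| ≤ k₁ / θlo * ‖c‖ ^ 2 := by
  have hθ0 : 0 < θ := hθlo.trans_le hθ
  have hk : 0 ≤ k₁ := (norm_nonneg B).trans hB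
  have hd0 : (0 : ℝ) < d := by exact_mod_cast hd
  rw [abs_div, abs_mul, abs_of_pos (by positivity : (0 : ℝ) < d * θ),
    abs_of_nonneg (by positivity : 0 ≤ ‖c‖ ^ 2)]
  have h1 : |divergence B| ≤ d * k₁ := (abs_divergence_le B).trans (by gcongr)
  calc ‖c‖ ^ 2 * |divergence B| / (d * θ) ≤ ‖c‖ ^ 2 * (d * k₁) / (d * θlo) := by gcongr
    _ = _ := by field_simp

/-- The polynomial is cubic, so its square costs six velocity moments. In the applications `W`
bounds a fixed velocity and `s` is the length of the integration variable. -/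
theorem transportPoly_sq_le (hd : 1 ≤ d) (hθlo : 0 < θlo) (hθ : θlo ≤ θ) (hB : ‖B‖ ≤ k₁)
    (hℓ : ‖ℓ‖ ≤ k₂) {W s : ℝ} (hW : 0 ≤ W) (hs : 0 ≤ s) {c : E d} (hc : ‖c‖ ≤ W + s) :
    transportPoly θ B ℓ c ^ 2
      ≤ (2 * k₁ / θlo + k₂ * (1 / (2 * θlo) + (d + 2) / 2)) ^ 2 * (1 + W) ^ 6 * 32 * (1 + s ^ 6) := by
  have hθ0 : 0 < θ := hθlo.trans_le hθ
  have hk₁ : 0 ≤ k₁ := (norm_nonneg B).trans hB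
  have hk₂ : 0 ≤ k₂ := (norm_nonneg ℓ).trans hℓ
  -- Being at least 1 and at least `‖c‖`, `r` lets `r ^ 3` dominate every lower power of `‖c‖`.
  set r := (1 + W) * (1 + s) with hr
  have hcr : ‖c‖ ≤ r := by nlinarith [mul_nonneg hW hs]
  have hr1 : 1 ≤ r := by nlinarith [mul_nonneg hW hs]
  have hc0 := norm_nonneg c
  have p2 : ‖c‖ ^ 2 ≤ r ^ 3 :=
    (pow_le_pow_left₀ hc0 hcr 2).trans (pow_le_pow_right₀ hr1 (by norm_num))
  have p3 : ‖c‖ ^ 3 ≤ r ^ 3 := pow_le_pow_left₀ hc0 hcr 3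
  have p1 : ‖c‖ ≤ r ^ 3 := hcr.trans (by simpa using pow_le_pow_right₀ hr1 (show 1 ≤ 3 by norm_num))
  have h1 := abs_inner_clm_div_le hθlo hθ hB c
  have h2 := abs_norm_sq_mul_divergence_div_le hd hθlo hθ hB c
  have h3 : |ℓ c * (‖c‖ ^ 2 / (2 * θ) - (d + 2) / 2)|
      ≤ k₂ * (1 / (2 * θlo) + (d + 2) / 2) * r ^ 3 := by
    rw [abs_mul]
    have a1 : |ℓ c| ≤ k₂ * ‖c‖ := (ℓ.le_opNorm c).trans (by gcongr)
    have a2 : |‖c‖ ^ 2 / (2 * θ) - (d + 2) / 2| ≤ ‖c‖ ^ 2 / (2 * θlo) + (d + 2) / 2 := by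
      refine (abs_sub _ _).trans ?_
      rw [abs_of_nonneg (by positivity), abs_of_nonneg (by positivity)]
      gcongr
    calc |ℓ c| * |‖c‖ ^ 2 / (2 * θ) - (d + 2) / 2|
        ≤ (k₂ * ‖c‖) * (‖c‖ ^ 2 / (2 * θlo) + (d + 2) / 2) := by gcongr
      _ = k₂ * (‖c‖ ^ 3 / (2 * θlo) + ‖c‖ * ((d + 2) / 2)) := by ring
      _ ≤ k₂ * (r ^ 3 / (2 * θlo) + r ^ 3 * ((d + 2) / 2)) := by gcongr
      _ = _ := by ring
  have h4 : k₁ / θlo * ‖c‖ ^ 2 ≤ k₁ / θlo * r ^ 3 := by gcongr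
  have h5 : |transportPoly θ B ℓ c|
      ≤ (2 * k₁ / θlo + k₂ * (1 / (2 * θlo) + (d + 2) / 2)) * r ^ 3 := by
    unfold transportPoly
    refine (abs_add_le _ _).trans ?_
    have := abs_sub (inner ℝ c (B c) / θ) (‖c‖ ^ 2 * divergence B / (d * θ))
    have e : 2 * k₁ / θlo = k₁ / θlo + k₁ / θlo := by ring
    rw [e]
    linarith
  rw [← sq_abs]
  refine (pow_le_pow_left₀ (abs_nonneg _) h5 2).trans ?_
  have h6 : (1 + s) ^ 6 ≤ 32 * (1 + s ^ 6) := by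
    have := add_pow_le (zero_le_one' ℝ) hs 6
    norm_num at this; linarith
  calc ((2 * k₁ / θlo + k₂ * (1 / (2 * θlo) + (d + 2) / 2)) * r ^ 3) ^ 2
      = (2 * k₁ / θlo + k₂ * (1 / (2 * θlo) + (d + 2) / 2)) ^ 2 * (1 + W) ^ 6 * (1 + s) ^ 6 := by
        rw [hr]; ring
    _ ≤ (2 * k₁ / θlo + k₂ * (1 / (2 * θlo) + (d + 2) / 2)) ^ 2 * (1 + W) ^ 6
          * (32 * (1 + s ^ 6)) := by gcongr
    _ = _ := by ring

theorem integrable_maxwellian_mul_transportPoly (hd : 1 ≤ d) (hθ : 0 < θ) (ρ : ℝ) {θ' : ℝ}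
    (hθ' : 0 < θ') (u u' : E d) :
    Integrable fun v => maxwellian ρ u' θ' v * transportPoly θ B ℓ (v - u) := by
  refine integrable_maxwellian_mul (K := 1 + (2 * ‖B‖ / θ + ‖ℓ‖ * (1 / (2 * θ) + (d + 2) / 2)) ^ 2
    * (1 + ‖u' - u‖) ^ 6 * 32) ρ hθ' u'
    ((continuous_transportPoly θ B ℓ).comp (continuous_id.sub continuous_const)) fun v => ?_
  have h := transportPoly_sq_le hd hθ le_rfl (le_refl ‖B‖) (le_refl ‖ℓ‖) (norm_nonneg (u' - u))
    (norm_nonneg (v - u')) (c := v - u) (by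
      rw [add_comm]; simpa using norm_add_le (v - u') (u' - u))
  -- `|P| ≤ 1 + P²` reduces the growth of `P` to the sixth-power bound on its square.
  have h1 : |transportPoly θ B ℓ (v - u)| ≤ 1 + transportPoly θ B ℓ (v - u) ^ 2 := by
    rw [← sq_abs]; nlinarith [sq_nonneg (|transportPoly θ B ℓ (v - u)| - 1)]
  have h2 : 0 ≤ ‖v - u'‖ ^ 6 := by positivity
  change |transportPoly θ B ℓ (v - u)| ≤ _
  nlinarith

/-- The flux of the local equilibrium against the transport polynomial only involves
`w = u' - u` and `θ' - θ`, quadratically. -/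
theorem integral_maxwellian_mul_transportPoly (hd : 1 ≤ d) (hθ : 0 < θ) (ρ : ℝ) {θ' : ℝ}
    (hθ' : 0 < θ') (u u' : E d) :
    ∫ v, maxwellian ρ u' θ' v * transportPoly θ B ℓ (v - u)
      = ρ * (inner ℝ (u' - u) (B (u' - u)) / θ - ‖u' - u‖ ^ 2 * divergence B / (d * θ)
        + ℓ (u' - u) * (‖u' - u‖ ^ 2 / (2 * θ) + (d + 2) / 2 * ((θ' - θ) / θ))) := by
  set w := u' - u with hw
  have hd0 : (d : ℝ) ≠ 0 := by positivity
  have eshift : ∀ v, maxwellian ρ u' θ' v * transportPoly θ B ℓ (v - u)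
      = (fun ξ => maxwellian ρ 0 θ' ξ * transportPoly θ B ℓ (ξ + w)) (v - u') := fun v => by
    simp only [hw]; rw [maxwellian_eq_shift, sub_add_sub_cancel]
  simp_rw [eshift]
  rw [integral_sub_right_eq_self (fun ξ => maxwellian ρ 0 θ' ξ * transportPoly θ B ℓ (ξ + w)) u']
  have hIp : Integrable fun ξ => maxwellian ρ 0 θ' ξ * transportPoly θ B ℓ (ξ + w) := by
    simpa using integrable_maxwellian_mul_transportPoly (B := B) (ℓ := ℓ) hd hθ ρ hθ' (-w) 0
  set κ := inner ℝ w (B w) / θ - ‖w‖ ^ 2 * divergence B / (d * θ)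
    + ℓ w * (‖w‖ ^ 2 / (2 * θ) - (d + 2) / 2) with hκ
  -- The even part in `ξ` of the polynomial at `ξ + w`, with `κ` its value at `w`. The odd remainder
  -- integrates to zero against the centred Maxwellian.
  set ev : E d → ℝ := fun ξ => 1 / θ * inner ℝ ξ (B ξ) + (ℓ w / (2 * θ) - divergence B / (d * θ)) * ‖ξ‖ ^ 2
    + 1 / θ * (inner ℝ ξ w * ℓ ξ) + κ with hev
  have hodd : ∀ ξ, (transportPoly θ B ℓ (-ξ + w) - ev (-ξ)) = -(transportPoly θ B ℓ (ξ + w) - ev ξ) := by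
    intro ξ
    simp only [hev, hκ, transportPoly, map_add, map_neg, inner_add_left, inner_add_right,
      inner_neg_left, inner_neg_right, norm_add_sq_real, norm_neg]
    field_simp
    ring
  have quad : ∀ (g : E d → ℝ) (K : ℝ), Continuous g → (∀ ξ, |g ξ| ≤ K * ‖ξ‖ ^ 2) →
      Integrable fun ξ => maxwellian ρ 0 θ' ξ * g ξ := by
    intro g K hg hK
    refine integrable_maxwellian_mul (K := |K|) ρ hθ' 0 hg fun v => (hK v).trans ?_
    rw [sub_zero]
    calc K * ‖v‖ ^ 2 ≤ |K| * ‖v‖ ^ 2 := by gcongr; exact le_abs_self K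
      _ ≤ _ := by
        gcongr; exact pow_le_one_add_pow_six (norm_nonneg v) (by norm_num)
  have Q1 : Integrable fun ξ : E d => maxwellian ρ 0 θ' ξ * inner ℝ ξ (B ξ) :=
    quad _ ‖B‖ (by fun_prop) fun ξ => by
      calc |inner ℝ ξ (B ξ)| ≤ ‖ξ‖ * ‖B ξ‖ := abs_real_inner_le_norm _ _
        _ ≤ ‖ξ‖ * (‖B‖ * ‖ξ‖) := by gcongr; exact B.le_opNorm ξ
        _ = _ := by ring
  have Q2 : Integrable fun ξ : E d => maxwellian ρ 0 θ' ξ * ‖ξ‖ ^ 2 :=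
    quad _ 1 (by fun_prop) fun ξ => by rw [abs_of_nonneg (by positivity), one_mul]
  have Q3 : Integrable fun ξ : E d => maxwellian ρ 0 θ' ξ * (inner ℝ ξ w * ℓ ξ) :=
    quad _ (‖w‖ * ‖ℓ‖) (by fun_prop) fun ξ => by
      rw [abs_mul]
      calc |inner ℝ ξ w| * |ℓ ξ| ≤ (‖ξ‖ * ‖w‖) * (‖ℓ‖ * ‖ξ‖) := by
            gcongr
            · exact abs_real_inner_le_norm _ _
            · exact ℓ.le_opNorm ξ
        _ = _ := by ring
  have Q0 := integrable_maxwellian ρ hθ' (0 : E d)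
  have eev : (fun ξ => maxwellian ρ 0 θ' ξ * ev ξ) = fun ξ =>
      1 / θ * (maxwellian ρ 0 θ' ξ * inner ℝ ξ (B ξ))
      + (ℓ w / (2 * θ) - divergence B / (d * θ)) * (maxwellian ρ 0 θ' ξ * ‖ξ‖ ^ 2)
      + 1 / θ * (maxwellian ρ 0 θ' ξ * (inner ℝ ξ w * ℓ ξ)) + maxwellian ρ 0 θ' ξ * κ := by
    funext ξ; simp only [hev]; ring
  have R1 : Integrable fun ξ => 1 / θ * (maxwellian ρ 0 θ' ξ * inner ℝ ξ (B ξ))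
      + (ℓ w / (2 * θ) - divergence B / (d * θ)) * (maxwellian ρ 0 θ' ξ * ‖ξ‖ ^ 2) :=
    (Q1.const_mul _).add (Q2.const_mul _)
  have R2 : Integrable fun ξ => 1 / θ * (maxwellian ρ 0 θ' ξ * inner ℝ ξ (B ξ))
      + (ℓ w / (2 * θ) - divergence B / (d * θ)) * (maxwellian ρ 0 θ' ξ * ‖ξ‖ ^ 2)
      + 1 / θ * (maxwellian ρ 0 θ' ξ * (inner ℝ ξ w * ℓ ξ)) := R1.add (Q3.const_mul _)
  have hIev : Integrable fun ξ => maxwellian ρ 0 θ' ξ * ev ξ := by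
    rw [eev]; exact R2.add (Q0.mul_const κ)
  have hsplit : ∫ ξ, maxwellian ρ 0 θ' ξ * transportPoly θ B ℓ (ξ + w)
      = ∫ ξ, maxwellian ρ 0 θ' ξ * ev ξ := by
    have h := integral_maxwellian_mul_odd ρ θ' (g := fun ξ => transportPoly θ B ℓ (ξ + w) - ev ξ) hodd
    simp only [mul_sub] at h
    rw [integral_sub hIp hIev] at h
    linarith
  rw [hsplit, eev, integral_add R2 (Q0.mul_const κ), integral_add R1 (Q3.const_mul _),
    integral_add (Q1.const_mul _) (Q2.const_mul _), integral_const_mul, integral_const_mul,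
    integral_const_mul, integral_mul_const, integral_maxwellian ρ hθ',
    integral_maxwellian_inner_clm ρ hθ', integral_maxwellian_norm_sq ρ hθ',
    integral_maxwellian_inner_mul ρ hθ']
  -- The two divergence terms of second order in `ξ` cancel. The terms linear in `ℓ w` combine to
  -- `(d + 2)/2 · (θ' - θ)/θ`, so every surviving term is at least quadratic in `(w, θ' - θ)`.
  change 1 / θ * (ρ * θ' * divergence B) + _ + _ + _ = _
  rw [hκ]
  field_simp
  ring

/-- The constant in the bound of the equilibrium flux. -/
noncomputable def fluxConst (d : ℕ) (θlo k₁ k₂ W : ℝ) : ℝ :=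
  2 * k₁ / θlo + k₂ * (W / (2 * θlo) + (d + 2) / (2 * θlo))

/-- The cubic term in `w` is made quadratic by `‖w‖ ≤ W`, and the product `‖w‖ |θ' - θ|` is split by
Young's inequality. -/
theorem abs_integral_maxwellian_mul_transportPoly_le (hd : 1 ≤ d) (hθlo : 0 < θlo) (hθ : θlo ≤ θ)
    (hB : ‖B‖ ≤ k₁) (hℓ : ‖ℓ‖ ≤ k₂) {ρ θ' W : ℝ} (hρ : 0 ≤ ρ) (hθ' : 0 < θ') {u u' : E d}
    (hW : ‖u' - u‖ ≤ W) :
    |∫ v, maxwellian ρ u' θ' v * transportPoly θ B ℓ (v - u)|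
      ≤ fluxConst d θlo k₁ k₂ W * (ρ * (‖u' - u‖ ^ 2 + (θ' - θ) ^ 2)) := by
  have hθ0 : 0 < θ := hθlo.trans_le hθ
  have hk₁ : 0 ≤ k₁ := (norm_nonneg B).trans hB
  have hk₂ : 0 ≤ k₂ := (norm_nonneg ℓ).trans hℓ
  rw [integral_maxwellian_mul_transportPoly hd hθ0 ρ hθ']
  set w := u' - u
  have hW0 : 0 ≤ W := (norm_nonneg w).trans hW
  have h1 := abs_inner_clm_div_le hθlo hθ hB w
  have h2 := abs_norm_sq_mul_divergence_div_le hd hθlo hθ hB w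
  have h3 : |ℓ w * (‖w‖ ^ 2 / (2 * θ) + (d + 2) / 2 * ((θ' - θ) / θ))|
      ≤ k₂ * (W / (2 * θlo) + (d + 2) / (2 * θlo)) * (‖w‖ ^ 2 + (θ' - θ) ^ 2) := by
    rw [abs_mul]
    have a1 : |ℓ w| ≤ k₂ * ‖w‖ := (ℓ.le_opNorm w).trans (by gcongr)
    have a2 : |‖w‖ ^ 2 / (2 * θ) + (d + 2) / 2 * ((θ' - θ) / θ)|
        ≤ ‖w‖ ^ 2 / (2 * θlo) + (d + 2) / 2 * (|θ' - θ| / θlo) := by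
      refine (abs_add_le _ _).trans ?_
      rw [abs_of_nonneg (by positivity : 0 ≤ ‖w‖ ^ 2 / (2 * θ)), abs_mul,
        abs_div (θ' - θ), abs_of_pos hθ0, abs_of_nonneg (by positivity : (0 : ℝ) ≤ (d + 2) / 2)]
      gcongr
    have a3 : ‖w‖ * |θ' - θ| ≤ ‖w‖ ^ 2 + (θ' - θ) ^ 2 := by
      rw [← sq_abs (θ' - θ)]
      nlinarith [sq_nonneg (‖w‖ - |θ' - θ|), sq_nonneg ‖w‖, sq_nonneg |θ' - θ|]
    have a4 : ‖w‖ * ‖w‖ ^ 2 ≤ W * (‖w‖ ^ 2 + (θ' - θ) ^ 2) := by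
      refine mul_le_mul hW (by nlinarith [sq_nonneg (θ' - θ)]) (by positivity) hW0
    calc |ℓ w| * |‖w‖ ^ 2 / (2 * θ) + (d + 2) / 2 * ((θ' - θ) / θ)|
        ≤ (k₂ * ‖w‖) * (‖w‖ ^ 2 / (2 * θlo) + (d + 2) / 2 * (|θ' - θ| / θlo)) := by gcongr
      _ = k₂ * ((‖w‖ * ‖w‖ ^ 2) / (2 * θlo) + (d + 2) / (2 * θlo) * (‖w‖ * |θ' - θ|)) := by
          field_simp
      _ ≤ k₂ * ((W * (‖w‖ ^ 2 + (θ' - θ) ^ 2)) / (2 * θlo)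
            + (d + 2) / (2 * θlo) * (‖w‖ ^ 2 + (θ' - θ) ^ 2)) := by gcongr
      _ = _ := by ring
  rw [abs_mul, abs_of_nonneg hρ]
  have h4 : k₁ / θlo * ‖w‖ ^ 2 ≤ k₁ / θlo * (‖w‖ ^ 2 + (θ' - θ) ^ 2) := by
    gcongr; nlinarith [sq_nonneg (θ' - θ)]
  have h5 : |inner ℝ w (B w) / θ - ‖w‖ ^ 2 * divergence B / (d * θ)
        + ℓ w * (‖w‖ ^ 2 / (2 * θ) + (d + 2) / 2 * ((θ' - θ) / θ))|
      ≤ fluxConst d θlo k₁ k₂ W * (‖w‖ ^ 2 + (θ' - θ) ^ 2) := by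
    refine (abs_add_le _ _).trans ?_
    have := abs_sub (inner ℝ w (B w) / θ) (‖w‖ ^ 2 * divergence B / (d * θ))
    have e : fluxConst d θlo k₁ k₂ W * (‖w‖ ^ 2 + (θ' - θ) ^ 2)
        = k₁ / θlo * (‖w‖ ^ 2 + (θ' - θ) ^ 2) + k₁ / θlo * (‖w‖ ^ 2 + (θ' - θ) ^ 2)
          + k₂ * (W / (2 * θlo) + (d + 2) / (2 * θlo)) * (‖w‖ ^ 2 + (θ' - θ) ^ 2) := by
      unfold fluxConst; ring
    rw [e]; linarith
  calc _ ≤ ρ * (fluxConst d θlo k₁ k₂ W * (‖w‖ ^ 2 + (θ' - θ) ^ 2)) := by gcongr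
    _ = _ := by ring

end TransportPoly

/-! ### Transport of the logarithm of the Maxwellian along an Euler flow -/

theorem hasFDerivAt_coord {w : E d → E d} {B : E d →L[ℝ] E d} {x : E d} (hw : HasFDerivAt w B x)
    (i : Fin d) : HasFDerivAt (fun y => w y i) ((EuclideanSpace.proj i : E d →L[ℝ] ℝ).comp B) x :=
  (EuclideanSpace.proj i : E d →L[ℝ] ℝ).hasFDerivAt.comp x hw

/-- `∇ · (p w) = w · ∇p + p ∇ · w`. -/
theorem sum_dx_mul {p : E d → ℝ} {p' : E d →L[ℝ] ℝ} {w : E d → E d} {B : E d →L[ℝ] E d} {x : E d}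
    (hp : HasFDerivAt p p' x) (hw : HasFDerivAt w B x) :
    ∑ j, dx j (fun y => p y * w y j) x = p' (w x) + p x * divergence B := by
  have h : ∀ j, dx j (fun y => p y * w y j) x
      = p x * B (EuclideanSpace.single j 1) j + w x j * p' (EuclideanSpace.single j 1) := fun j => by
    unfold dx
    rw [(hp.fun_mul (hasFDerivAt_coord hw j)).fderiv]
    simp
  simp_rw [h]
  rw [Finset.sum_add_distrib, ← Finset.mul_sum, clm_apply_eq_sum p' (w x), divergence]
  ring

theorem hasDerivWithinAt_coord {w : ℝ → E d} {w' : E d} {S : Set ℝ} {t : ℝ}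
    (hw : HasDerivWithinAt w w' S t) (i : Fin d) : HasDerivWithinAt (fun s => w s i) (w' i) S t :=
  (EuclideanSpace.proj i : E d →L[ℝ] ℝ).hasFDerivAt.comp_hasDerivWithinAt t hw

/-! ### Restriction of jointly smooth functions to a fixed time or a fixed point. -/

section Slices

variable {F : Type*} [NormedAddCommGroup F] [NormedSpace ℝ F]
  {G : Type*} [NormedAddCommGroup G] [NormedSpace ℝ G] {T : ℝ}

theorem contDiff_space_slice {g : ℝ → F → G}
    (hg : ContDiffOn ℝ ∞ (fun p : ℝ × F => g p.1 p.2) (Ico 0 T ×ˢ univ)) {t : ℝ}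
    (ht : t ∈ Ico 0 T) : ContDiff ℝ ∞ (g t) := by
  rw [← contDiffOn_univ]
  exact hg.comp (f := fun x : F => (t, x)) (by fun_prop) fun x _ => ⟨ht, mem_univ _⟩

theorem contDiffOn_time_slice {g : ℝ → F → G}
    (hg : ContDiffOn ℝ ∞ (fun p : ℝ × F => g p.1 p.2) (Ico 0 T ×ˢ univ)) (x : F) :
    ContDiffOn ℝ ∞ (fun s => g s x) (Ico 0 T) :=
  hg.comp (f := fun s : ℝ => (s, x)) (by fun_prop) fun _ hs => ⟨hs, mem_univ _⟩

end Slices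

/-! ### The Euler system in primitive variables and the transport of `log M`. -/

section Euler

variable {T : ℝ} {ρ : ℝ → E d → ℝ} {u : ℝ → E d → E d} {θ : ℝ → E d → ℝ}

theorem IsEulerSolution.hasDerivs (h : IsEulerSolution T ρ u θ) {t : ℝ} (ht : t ∈ Ico 0 T)
    (x : E d) :
    ∃ (ρt : ℝ) (θt : ℝ) (ut : E d),
      HasDerivWithinAt (fun s => ρ s x) ρt (Ico 0 T) t ∧
      HasDerivWithinAt (fun s => u s x) ut (Ico 0 T) t ∧
      HasDerivWithinAt (fun s => θ s x) θt (Ico 0 T) t ∧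
      HasFDerivAt (ρ t) (fderiv ℝ (ρ t) x) x ∧ HasFDerivAt (u t) (fderiv ℝ (u t) x) x ∧
      HasFDerivAt (θ t) (fderiv ℝ (θ t) x) x :=
  ⟨_, _, _,
    ((contDiffOn_time_slice h.smooth_density x).differentiableOn (by norm_num) t ht).hasDerivWithinAt,
    ((contDiffOn_time_slice h.smooth_velocity x).differentiableOn (by norm_num) t
      ht).hasDerivWithinAt,
    ((contDiffOn_time_slice h.smooth_temperature x).differentiableOn (by norm_num) t
      ht).hasDerivWithinAt,
    ((contDiff_space_slice h.smooth_density ht).differentiable (by norm_num) x).hasFDerivAt,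
    ((contDiff_space_slice h.smooth_velocity ht).differentiable (by norm_num) x).hasFDerivAt,
    ((contDiff_space_slice h.smooth_temperature ht).differentiable (by norm_num) x).hasFDerivAt⟩

/-- The Euler system in nonconservative form. -/
theorem IsEulerSolution.primitive (h : IsEulerSolution T ρ u θ) {t : ℝ} (ht : t ∈ Ico 0 T)
    {x : E d} {ρt θt : ℝ} {ut : E d} {a g : E d →L[ℝ] ℝ} {B : E d →L[ℝ] E d}
    (hρt : HasDerivWithinAt (fun s => ρ s x) ρt (Ico 0 T) t)
    (hut : HasDerivWithinAt (fun s => u s x) ut (Ico 0 T) t)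
    (hθt : HasDerivWithinAt (fun s => θ s x) θt (Ico 0 T) t)
    (ha : HasFDerivAt (ρ t) a x) (hB : HasFDerivAt (u t) B x) (hg : HasFDerivAt (θ t) g x) :
    ρt + a (u t x) + ρ t x * divergence B = 0 ∧
    (∀ c, ρ t x * (inner ℝ c ut + inner ℝ c (B (u t x))) + ρ t x * g c + θ t x * a c = 0) ∧
    d / 2 * (ρ t x * (θt + g (u t x))) + ρ t x * θ t x * divergence B = 0 := by
  have hu : UniqueDiffWithinAt ℝ (Ico 0 T) t := uniqueDiffOn_Ico 0 T t ht
  have mass : ρt + a (u t x) + ρ t x * divergence B = 0 := by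
    have := h.mass_eq t ht x
    rw [sum_dx_mul ha hB, dt, hρt.derivWithin hu] at this
    linarith
  have mom : ∀ i, ρ t x * (ut i + B (u t x) i) + ρ t x * g (EuclideanSpace.single i 1)
      + θ t x * a (EuclideanSpace.single i 1) = 0 := fun i => by
    have := h.momentum_eq t ht x i
    rw [sum_dx_mul (ha.fun_mul (hasFDerivAt_coord hB i)) hB, dt,
      (hρt.fun_mul (hasDerivWithinAt_coord hut i)).derivWithin hu, dx, (ha.fun_mul hg).fderiv] at this
    simp at this
    -- Subtracting `u_i` times the mass equation leaves the acceleration equation.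
    linear_combination this - u t x i * mass
  have momc : ∀ c, ρ t x * (inner ℝ c ut + inner ℝ c (B (u t x))) + ρ t x * g c + θ t x * a c = 0 := by
    intro c
    rw [clm_apply_eq_sum g c, clm_apply_eq_sum a c, PiLp.inner_apply, PiLp.inner_apply,
      ← Finset.sum_add_distrib, Finset.mul_sum, Finset.mul_sum, Finset.mul_sum,
      ← Finset.sum_add_distrib, ← Finset.sum_add_distrib]
    refine Finset.sum_eq_zero fun i _ => ?_
    simp
    linear_combination c i * mom i
  refine ⟨mass, momc, ?_⟩
  have en := h.energy_eq t ht x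
  have e1 : ∀ j, dx j (fun y => u t y j * (energy ρ u θ t y + ρ t y * θ t y)) x
      = dx j (fun y => (energy ρ u θ t y + ρ t y * θ t y) * u t y j) x := fun j => by
    simp_rw [mul_comm (u t _ j)]
  simp_rw [e1] at en
  have hex : HasFDerivAt (fun y => energy ρ u θ t y + ρ t y * θ t y) _ x :=
    (((ha.mul hB.norm_sq).mul_const (2 : ℝ)⁻¹).add ((ha.mul hg).const_mul ((d : ℝ) / 2))).add
      (ha.mul hg)
  have het : HasDerivWithinAt (fun s => energy ρ u θ s x) _ (Ico 0 T) t :=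
    ((hρt.mul hut.norm_sq).div_const 2).add ((hρt.mul hθt).const_mul ((d : ℝ) / 2))
  rw [sum_dx_mul hex hB, dt, het.derivWithin hu] at en
  simp [energy] at en
  -- Removing the kinetic energy balance (momentum tested with `u`) and the mass equation from the
  -- energy equation leaves the temperature equation.
  linear_combination en - (‖u t x‖ ^ 2 / 2 + d / 2 * θ t x) * mass - momc (u t x)

theorem IsEulerSolution.hasDeriv_log_maxwellian (hρ : ∀ t ∈ Ico 0 T, ∀ x, 0 < ρ t x)
    (hθ : ∀ t ∈ Ico 0 T, ∀ x, 0 < θ t x) {t : ℝ} (ht : t ∈ Ico 0 T)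
    (x v : E d) {ρt θt : ℝ} {ut : E d} {a g : E d →L[ℝ] ℝ} {B : E d →L[ℝ] E d}
    (hρt : HasDerivWithinAt (fun s => ρ s x) ρt (Ico 0 T) t)
    (hut : HasDerivWithinAt (fun s => u s x) ut (Ico 0 T) t)
    (hθt : HasDerivWithinAt (fun s => θ s x) θt (Ico 0 T) t)
    (ha : HasFDerivAt (ρ t) a x) (hB : HasFDerivAt (u t) B x) (hg : HasFDerivAt (θ t) g x) :
    HasDerivWithinAt (fun s => Real.log (targetMaxwellian ρ u θ s x v))
      (ρt / ρ t x - d / 2 * (θt / θ t x) + inner ℝ (v - u t x) ut / θ t x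
        + ‖v - u t x‖ ^ 2 * θt / (2 * θ t x ^ 2)) (Ico 0 T) t ∧
    ∃ L : E d →L[ℝ] ℝ, HasFDerivAt (fun y => Real.log (targetMaxwellian ρ u θ t y v)) L x ∧
      ∀ w, L w = a w / ρ t x - d / 2 * (g w / θ t x) + inner ℝ (v - u t x) (B w) / θ t x
        + ‖v - u t x‖ ^ 2 * g w / (2 * θ t x ^ 2) := by
  have hρ0 := hρ t ht x
  have hθ0 := hθ t ht x
  have hpi := Real.pi_pos
  constructor
  · have e : ∀ s ∈ Ico 0 T, Real.log (targetMaxwellian ρ u θ s x v)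
        = Real.log (ρ s x) - d / 2 * Real.log (2 * Real.pi * θ s x)
          - ‖v - u s x‖ ^ 2 / (2 * θ s x) := fun s hs =>
      log_maxwellian (hρ s hs x) (hθ s hs x) _ _
    have key := ((hρt.log hρ0.ne').sub
      (((hθt.const_mul (2 * Real.pi)).log (by positivity)).const_mul ((d : ℝ) / 2))).sub
      ((hut.const_sub v).norm_sq.div (hθt.const_mul 2) (by positivity))
    refine (key.congr e (e t ht)).congr_deriv ?_
    simp only [inner_neg_right]
    field_simp
    ring
  · have e : (fun y => Real.log (targetMaxwellian ρ u θ t y v))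
        = fun y => Real.log (ρ t y) - d / 2 * Real.log (2 * Real.pi * θ t y)
          - ‖v - u t y‖ ^ 2 * (2 * θ t y)⁻¹ := by
      funext y
      rw [← div_eq_mul_inv]
      exact log_maxwellian (hρ t ht y) (hθ t ht y) _ _
    have key := ((ha.log hρ0.ne').sub
      (((hg.const_mul (2 * Real.pi)).log (by positivity)).const_mul ((d : ℝ) / 2))).sub
      ((hB.const_sub v).norm_sq.mul ((hasDerivAt_inv (by positivity)).comp_hasFDerivAt x
        (hg.const_mul 2)))
    rw [e]
    refine ⟨_, key, fun w => ?_⟩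
    simp [inner_sub_left]
    field_simp
    ring

theorem IsEulerSolution.differentiableWithinAt_log_maxwellian (h : IsEulerSolution T ρ u θ)
    (hρ : ∀ t ∈ Ico 0 T, ∀ x, 0 < ρ t x) (hθ : ∀ t ∈ Ico 0 T, ∀ x, 0 < θ t x) {t : ℝ}
    (ht : t ∈ Ico 0 T) (x v : E d) :
    DifferentiableWithinAt ℝ (fun s => Real.log (targetMaxwellian ρ u θ s x v)) (Ico 0 T) t := by
  obtain ⟨_, _, _, h1, h2, h3, h4, h5, h6⟩ := h.hasDerivs ht x
  exact (hasDeriv_log_maxwellian hρ hθ ht x v h1 h2 h3 h4 h5 h6).1.differentiableWithinAt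

theorem IsEulerSolution.differentiableAt_log_maxwellian (h : IsEulerSolution T ρ u θ)
    (hρ : ∀ t ∈ Ico 0 T, ∀ x, 0 < ρ t x) (hθ : ∀ t ∈ Ico 0 T, ∀ x, 0 < θ t x) {t : ℝ}
    (ht : t ∈ Ico 0 T) (x v : E d) :
    DifferentiableAt ℝ (fun y => Real.log (targetMaxwellian ρ u θ t y v)) x := by
  obtain ⟨_, _, _, h1, h2, h3, h4, h5, h6⟩ := h.hasDerivs ht x
  obtain ⟨L, hL, -⟩ := (hasDeriv_log_maxwellian hρ hθ ht x v h1 h2 h3 h4 h5 h6).2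
  exact hL.differentiableAt

/-- `(∂_t + v·∇) log M` is the transport polynomial in the relative velocity. -/
theorem IsEulerSolution.transport_log_maxwellian (hd : 1 ≤ d) (h : IsEulerSolution T ρ u θ)
    (hρ : ∀ t ∈ Ico 0 T, ∀ x, 0 < ρ t x) (hθ : ∀ t ∈ Ico 0 T, ∀ x, 0 < θ t x) {t : ℝ}
    (ht : t ∈ Ico 0 T) (x v : E d) :
    dt T (fun s => Real.log (targetMaxwellian ρ u θ s x v)) t
      + dirDeriv v (fun y => Real.log (targetMaxwellian ρ u θ t y v)) x
      = transportPoly (θ t x) (fderiv ℝ (u t) x) (fderiv ℝ (fun y => Real.log (θ t y)) x)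
          (v - u t x) := by
  obtain ⟨ρt, θt, ut, h1, h2, h3, h4, h5, h6⟩ := h.hasDerivs ht x
  obtain ⟨k1, L, hL, k2⟩ := hasDeriv_log_maxwellian hρ hθ ht x v h1 h2 h3 h4 h5 h6
  obtain ⟨mass, mom, temp⟩ := h.primitive ht h1 h2 h3 h4 h5 h6
  have hρ0 := hρ t ht x
  have hθ0 := hθ t ht x
  have hd0 : (d : ℝ) ≠ 0 := by positivity
  rw [dt, k1.derivWithin (uniqueDiffOn_Ico 0 T t ht), dirDeriv, hL.fderiv, k2,
    (h6.log hθ0.ne').fderiv]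
  set c := v - u t x with hc
  have hv : v = u t x + c := by rw [hc]; abel
  set B := fderiv ℝ (u t) x
  set a := fderiv ℝ (ρ t) x
  set g := fderiv ℝ (θ t) x
  have m := mom c
  rw [hv]
  simp only [map_add, inner_add_right, transportPoly, smul_apply, smul_eq_mul]
  -- The Euler equations are solved for the time derivatives; of `∂_t u` only the component along
  -- `c` enters. After substitution all terms in `∇ρ` cancel.
  have e1 : ρt = -(a (u t x)) - ρ t x * divergence B := by linarith
  have e2 : inner ℝ c ut = -inner ℝ c (B (u t x)) - g c - θ t x / ρ t x * a c := by
    field_simp; linarith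
  have e3 : θt = -(g (u t x)) - 2 / d * (θ t x * divergence B) := by
    have : (d : ℝ) * ρ t x * (θt + g (u t x) + 2 / d * (θ t x * divergence B)) = 0 := by
      field_simp; linarith
    have h0 : (d : ℝ) * ρ t x ≠ 0 := by positivity
    have := (mul_eq_zero.1 this).resolve_left h0
    linarith
  rw [e1, e2, e3]
  field_simp
  ring

end Euler

/-! ### Differentiating the relative entropy -/

section EntropyDerivative

variable {T : ℝ} {f M : ℝ → E d → E d → ℝ}

/-- The time derivative of `f log (f / M)`. -/
noncomputable def entropyDt (T : ℝ) (f M : ℝ → E d → E d → ℝ) (t : ℝ) (p : E d × E d) : ℝ :=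
  dt T (fun s => f s p.1 p.2) t * (Real.log (f t p.1 p.2 / M t p.1 p.2) + 1)
    - f t p.1 p.2 * dt T (fun s => Real.log (M s p.1 p.2)) t

/-- The transport derivative `v · ∇_x` of `f log (f / M)`. -/
noncomputable def entropyDx (f M : ℝ → E d → E d → ℝ) (t : ℝ) (p : E d × E d) : ℝ :=
  dirDeriv p.2 (fun y => f t y p.2) p.1 * (Real.log (f t p.1 p.2 / M t p.1 p.2) + 1)
    - f t p.1 p.2 * dirDeriv p.2 (fun y => Real.log (M t y p.2)) p.1

theorem abs_mul_log_sub_le (a b l m : ℝ) (hb : 0 ≤ b) :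
    |a * (l + 1) - b * m| ≤ |a| * (1 + |l|) + b * |m| := by
  refine (abs_sub _ _).trans ?_
  rw [abs_mul, abs_mul, abs_of_nonneg hb]
  have : |l + 1| ≤ 1 + |l| := by
    have := abs_add_le l 1
    rw [abs_one] at this; linarith
  gcongr

theorem mul_log_div_eq (a : ℝ) {m : ℝ} (hm : 0 < m) :
    a * Real.log (a / m) = a * Real.log a - a * Real.log m := by
  rcases eq_or_ne a 0 with rfl | ha
  · simp
  · rw [Real.log_div ha hm.ne']; ring

/-- Differentiation of `q log (q / m)`, also at zeros of `q`. -/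
theorem hasDerivWithinAt_mul_log_div {S : Set ℝ} (hS : Convex ℝ S) (hu : UniqueDiffOn ℝ S)
    {q m : ℝ → ℝ} (hq : ContDiffOn ℝ 2 q S) (hm : ∀ s ∈ S, 0 < m s) {a m' : ℝ} (ha : a ∈ S)
    (hm' : HasDerivWithinAt (fun s => Real.log (m s)) m' S a)
    (h1 : q a = 0 → derivWithin q S a = 0) :
    HasDerivWithinAt (fun s => q s * Real.log (q s / m s))
      (derivWithin q S a * (Real.log (q a / m a) + 1) - q a * m') S a := by
  have hd : HasDerivWithinAt q (derivWithin q S a) S a :=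
    (hq.differentiableOn (by norm_num) a ha).hasDerivWithinAt
  have key := (hasDerivWithinAt_mul_log hS hu hq ha h1).sub (hd.mul hm')
  refine (key.congr (fun s hs => mul_log_div_eq (q s) (hm s hs))
    (mul_log_div_eq (q a) (hm a ha))).congr_deriv ?_
  by_cases h0 : q a = 0
  · simp [h0, h1 h0]
  · rw [Real.log_div h0 (hm a ha).ne']; ring

variable (hs : ContDiffOn ℝ ∞ (fun p : ℝ × E d × E d => f p.1 p.2.1 p.2.2) (Ico 0 T ×ˢ univ))
  (h0 : ∀ t ∈ Ico 0 T, ∀ x v, 0 ≤ f t x v)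
  (hM0 : ∀ t ∈ Ico 0 T, ∀ x v, 0 < M t x v)

include hs in
theorem contDiff_phase_slice {t : ℝ} (ht : t ∈ Ico 0 T) :
    ContDiff ℝ ∞ (fun p : E d × E d => f t p.1 p.2) :=
  contDiff_space_slice (g := fun t (p : E d × E d) => f t p.1 p.2) hs ht

include hs in
theorem contDiffOn_time_phase (x v : E d) :
    ContDiffOn ℝ ∞ (fun s => f s x v) (Ico 0 T) :=
  contDiffOn_time_slice (g := fun t (p : E d × E d) => f t p.1 p.2) hs (x, v)

include h0 in
-- A zero of a nonnegative function is a global minimum, and space has no boundary.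
theorem dirDeriv_eq_zero_of_eq_zero {t : ℝ} (ht : t ∈ Ico 0 T) {x v : E d} (hz : f t x v = 0)
    (w : E d) : dirDeriv w (fun y => f t y v) x = 0 := by
  have : IsLocalMin (fun y => f t y v) x :=
    Eventually.of_forall fun y => hz.trans_le (h0 t ht y v)
  rw [dirDeriv, this.fderiv_eq_zero]; simp

include hs h0 hM0 in
-- Restriction to the line `s ↦ x + s v` reduces this to the one-variable rule for `q log (q / m)`,
-- valid at zeros too. A line derivative suffices for the integration by parts in `x`.
theorem hasLineDerivAt_entropyDensity
    (hMx : ∀ t ∈ Ico 0 T, ∀ x v, DifferentiableAt ℝ (fun y => Real.log (M t y v)) x)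
    {t : ℝ} (ht : t ∈ Ico 0 T) (x v : E d) :
    HasLineDerivAt ℝ (fun y => entropyDensity (f t) (M t) (y, v)) (entropyDx f M t (x, v)) x v := by
  have hfx : ContDiff ℝ ∞ (fun y => f t y v) :=
    (contDiff_phase_slice hs ht).comp (contDiff_id.prodMk contDiff_const)
  have hline : HasDerivAt (fun s : ℝ => x + s • v) v 0 := by
    simpa using ((hasDerivAt_id (0 : ℝ)).smul_const v).const_add x
  have hq : ContDiff ℝ ∞ (fun s : ℝ => f t (x + s • v) v) := hfx.comp (by fun_prop)
  have hqd : derivWithin (fun s : ℝ => f t (x + s • v) v) univ 0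
      = dirDeriv v (fun y => f t y v) x := by
    rw [derivWithin_univ]
    have h1 : HasFDerivAt (fun y => f t y v) (fderiv ℝ (fun y => f t y v) x) (x + (0 : ℝ) • v) := by
      rw [zero_smul, add_zero]
      exact (hfx.differentiable (by norm_num) x).hasFDerivAt
    exact (h1.comp_hasDerivAt (0 : ℝ) hline).deriv
  have hm : HasDerivWithinAt (fun s : ℝ => Real.log (M t (x + s • v) v))
      (dirDeriv v (fun y => Real.log (M t y v)) x) univ 0 := by
    have h1 : HasFDerivAt (fun y => Real.log (M t y v)) (fderiv ℝ (fun y => Real.log (M t y v)) x)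
        (x + (0 : ℝ) • v) := by
      rw [zero_smul, add_zero]; exact (hMx t ht x v).hasFDerivAt
    exact (h1.comp_hasDerivAt (0 : ℝ) hline).hasDerivWithinAt
  have := hasDerivWithinAt_mul_log_div convex_univ uniqueDiffOn_univ
    (m := fun s : ℝ => M t (x + s • v) v)
    (contDiffOn_infty.1 hq.contDiffOn 2) (fun s _ => hM0 t ht _ _) (mem_univ 0) hm
    (fun hz => by
      rw [hqd]; exact dirDeriv_eq_zero_of_eq_zero h0 ht (by simpa using hz) v)
  rw [hqd, hasDerivWithinAt_univ] at this
  simpa [HasLineDerivAt, entropyDensity, entropyDx] using this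

include hs in
theorem measurable_entropyDensity
    (hMm : ∀ t ∈ Ico 0 T, Measurable fun p : E d × E d => M t p.1 p.2)
    {t : ℝ} (ht : t ∈ Ico 0 T) : Measurable (entropyDensity (f t) (M t)) := by
  have hf : Measurable fun p : E d × E d => f t p.1 p.2 :=
    (contDiff_phase_slice hs ht).continuous.measurable
  exact hf.mul ((hf.div (hMm t ht)).log)

include hs h0 hM0 in
-- The direction of differentiation varies with the point, so joint measurability is read off from a
-- pointwise limit of difference quotients with step `1 / (n + 1)`.
theorem measurable_entropyDx
    (hMm : ∀ t ∈ Ico 0 T, Measurable fun p : E d × E d => M t p.1 p.2)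
    (hMx : ∀ t ∈ Ico 0 T, ∀ x v, DifferentiableAt ℝ (fun y => Real.log (M t y v)) x)
    {t : ℝ} (ht : t ∈ Ico 0 T) : Measurable (entropyDx f M t) := by
  have hφ := measurable_entropyDensity hs hMm ht
  have hseq : Tendsto (fun n : ℕ => ((n : ℝ) + 1)⁻¹) atTop (𝓝[≠] 0) := by
    refine tendsto_nhdsWithin_iff.2 ⟨?_, Eventually.of_forall fun n => ?_⟩
    · simpa using tendsto_one_div_add_atTop_nhds_zero_nat (𝕜 := ℝ)
    · have : (0 : ℝ) < (n : ℝ) + 1 := by positivity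
      exact (inv_pos.2 this).ne'
  refine measurable_of_tendsto_metrizable (f := fun (n : ℕ) (p : E d × E d) =>
    (((n : ℝ) + 1)⁻¹)⁻¹ • (entropyDensity (f t) (M t) (p.1 + ((n : ℝ) + 1)⁻¹ • p.2, p.2)
      - entropyDensity (f t) (M t) (p.1, p.2))) (fun n => ?_) (tendsto_pi_nhds.2 fun p => ?_)
  · have hshear : Measurable fun p : E d × E d => (p.1 + ((n : ℝ) + 1)⁻¹ • p.2, p.2) := by
      fun_prop
    exact ((hφ.comp hshear).sub hφ).const_smul (((n : ℝ) + 1)⁻¹)⁻¹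
  · exact (hasLineDerivAt_entropyDensity hs h0 hM0 hMx ht p.1 p.2).tendsto_slope_zero.comp hseq

include hs h0 hM0 in
theorem integrable_entropyDx
    (hMm : ∀ t ∈ Ico 0 T, Measurable fun p : E d × E d => M t p.1 p.2)
    (hMx : ∀ t ∈ Ico 0 T, ∀ x v, DifferentiableAt ℝ (fun y => Real.log (M t y v)) x)
    (hD : SufficientDecay T f M) {t : ℝ} (ht : t ∈ Ico 0 T) : Integrable (entropyDx f M t) := by
  refine (hD.transport_integrable t ht).mono'
    (measurable_entropyDx hs h0 hM0 hMm hMx ht).aestronglyMeasurable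
    (Eventually.of_forall fun p => ?_)
  exact abs_mul_log_sub_le _ _ _ _ (h0 t ht _ _)

include hs h0 hM0 in
/-- The transport derivative of the entropy density has zero integral. -/
theorem integral_entropyDx
    (hMm : ∀ t ∈ Ico 0 T, Measurable fun p : E d × E d => M t p.1 p.2)
    (hMx : ∀ t ∈ Ico 0 T, ∀ x v, DifferentiableAt ℝ (fun y => Real.log (M t y v)) x)
    (hD : SufficientDecay T f M) {t : ℝ} (ht : t ∈ Ico 0 T) : ∫ p, entropyDx f M t p = 0 := by
  have hI := integrable_entropyDx hs h0 hM0 hMm hMx hD ht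
  have hφ := hD.entropy_integrable t ht
  rw [Measure.volume_eq_prod] at hI hφ ⊢
  -- The `x`-integral is taken innermost: for fixed `v` the direction is constant, and integration
  -- by parts against the constant 1 applies to an integrable function with integrable derivative.
  rw [integral_prod_symm _ hI]
  refine integral_eq_zero_of_ae ?_
  filter_upwards [hI.prod_left_ae, hφ.prod_left_ae] with v h1 h2
  have := integral_bilinear_hasLineDerivAt_right_eq_neg_left_of_integrable
    (μ := (volume : Measure (E d))) (f := fun _ : E d => (1 : ℝ)) (f' := fun _ => 0)
    (g := fun y => entropyDensity (f t) (M t) (y, v)) (g' := fun x => entropyDx f M t (x, v))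
    (v := v) (B := ContinuousLinearMap.mul ℝ ℝ) (by simp) (by simpa using h1) (by simpa using h2)
    (fun x _ => by simpa [HasLineDerivAt] using hasDerivAt_const (0 : ℝ) (1 : ℝ))
    (fun x _ => hasLineDerivAt_entropyDensity hs h0 hM0 hMx ht x v)
  simpa using this

include hs h0 hM0 in
/-- Almost everywhere, `∂_t f` vanishes where `f` does. At `t = 0` this uses the domination of
`∂_t f log (f / M)`. -/
theorem dt_eq_zero_of_eq_zero
    (hMt : ∀ t ∈ Ico 0 T, ∀ x v,
      DifferentiableWithinAt ℝ (fun s => Real.log (M s x v)) (Ico 0 T) t)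
    {b G : ℝ} (hb : 0 < b) (hbT : b < T) {x v : E d}
    (hG : ∀ t ∈ Icc 0 b, |dt T (fun s => f s x v) t| * (1 + |Real.log (f t x v / M t x v)|)
        + f t x v * |dt T (fun s => Real.log (M s x v)) t| ≤ G)
    {t : ℝ} (ht : t ∈ Ico 0 T) (hz : f t x v = 0) : dt T (fun s => f s x v) t = 0 := by
  rcases ht.1.eq_or_lt with rfl | htpos
  · have hT : (0 : ℝ) ∈ Ico 0 T := ht
    have hcont : ContinuousWithinAt (fun s => M s x v) (Ico 0 T) 0 := by
      have := (hMt 0 hT x v).continuousWithinAt.rexp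
      refine this.congr (fun s hs => ?_) ?_
      · rw [Real.exp_log (hM0 s hs x v)]
      · rw [Real.exp_log (hM0 0 hT x v)]
    refine deriv_zero_of_mul_log_bounded (G := G) hb hbT
      (contDiffOn_infty.1 (contDiffOn_time_phase hs x v) 2) hcont (hM0 0 hT x v)
      hz fun s hsb => ?_
    have hsT : s ∈ Ico 0 T := ⟨hsb.1, hsb.2.trans_lt hbT⟩
    have h1 := hG s hsb
    have h2 : 0 ≤ f s x v * |dt T (fun s => Real.log (M s x v)) s| :=
      mul_nonneg (h0 s hsT x v) (abs_nonneg _)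
    unfold dt at h1 h2
    linarith
  · exact derivWithin_zero_of_interior_zero (Ico_mem_nhds htpos ht.2)
      (fun s hs => h0 s hs x v) hz

include hs h0 hM0 in
-- Dominated convergence for the difference quotients, which the mean value inequality bounds by the
-- dominating function of the decay hypothesis. The last conclusion is kept for deducing later that
-- the local Maxwellian vanishes wherever `f` does.
theorem hasDerivWithinAt_relEntropy
    (hMt : ∀ t ∈ Ico 0 T, ∀ x v,
      DifferentiableWithinAt ℝ (fun s => Real.log (M s x v)) (Ico 0 T) t)
    (hD : SufficientDecay T f M) {t : ℝ} (ht : t ∈ Ico 0 T) :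
    Integrable (entropyDt T f M t) ∧
    HasDerivWithinAt (fun s => relEntropy (f s) (M s)) (∫ p, entropyDt T f M t p) (Ico 0 T) t ∧
    ∀ᵐ p : E d × E d, f t p.1 p.2 = 0 → dt T (fun s => f s p.1 p.2) t = 0 := by
  -- A time strictly between `t` and `T`, so that `[0, b]` contains all points of `[0, T)` near `t`.
  set b := (t + T) / 2 with hbdef
  have htb : t < b := by rw [hbdef]; linarith [ht.2]
  have hbT : b < T := by rw [hbdef]; linarith [ht.2]
  have hb0 : 0 < b := ht.1.trans_lt htb
  obtain ⟨g, hg, hgb⟩ := hD.time_dominated b ⟨hb0.le, hbT⟩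
  have hsub : Icc 0 b ⊆ Ico 0 T := fun s hs => ⟨hs.1, hs.2.trans_lt hbT⟩
  have hzero : ∀ᵐ p : E d × E d, ∀ s ∈ Ico 0 T, f s p.1 p.2 = 0 →
      dt T (fun s => f s p.1 p.2) s = 0 := by
    filter_upwards [hgb] with p hp s hsT hz
    exact dt_eq_zero_of_eq_zero hs h0 hM0 hMt hb0 hbT hp hsT hz
  have hder : ∀ᵐ p : E d × E d, ∀ s ∈ Ico 0 T,
      HasDerivWithinAt (fun r => entropyDensity (f r) (M r) p) (entropyDt T f M s p)
        (Ico 0 T) s := by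
    filter_upwards [hzero] with p hp s hsT
    exact hasDerivWithinAt_mul_log_div (convex_Ico 0 T) (uniqueDiffOn_Ico 0 T)
      (m := fun r => M r p.1 p.2)
      (contDiffOn_infty.1 (contDiffOn_time_phase hs p.1 p.2) 2)
      (fun r hr => hM0 r hr _ _) hsT (hMt s hsT p.1 p.2).hasDerivWithinAt (hp s hsT)
  have hbound : ∀ᵐ p : E d × E d, ∀ s ∈ Icc 0 b, |entropyDt T f M s p| ≤ g p := by
    filter_upwards [hgb] with p hp s hsb
    exact (abs_mul_log_sub_le _ _ _ _ (h0 s (hsub hsb) _ _)).trans (hp s hsb)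
  have hev : ∀ᶠ s in 𝓝[Ico 0 T \ {t}] t, s ∈ Icc 0 b := by
    have h1 : ∀ᶠ s in 𝓝[Ico 0 T \ {t}] t, s < b := nhdsWithin_le_nhds (Iio_mem_nhds htb)
    filter_upwards [h1, self_mem_nhdsWithin] with s h1 h2 using ⟨h2.1.1, h1.le⟩
  have hlim : ∀ᵐ p : E d × E d, Tendsto
      (fun s => slope (fun r => entropyDensity (f r) (M r) p) t s) (𝓝[Ico 0 T \ {t}] t)
      (𝓝 (entropyDt T f M t p)) := by
    filter_upwards [hder] with p hp
    exact hasDerivWithinAt_iff_tendsto_slope.1 (hp t ht)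
  have hmeas : ∀ᶠ s in 𝓝[Ico 0 T \ {t}] t, AEStronglyMeasurable
      (fun p : E d × E d => slope (fun r => entropyDensity (f r) (M r) p) t s) volume := by
    filter_upwards [self_mem_nhdsWithin] with s hsT
    simp only [slope_def_field]
    exact (((hD.entropy_integrable s hsT.1).sub (hD.entropy_integrable t ht)).div_const _).1
  have hdom : ∀ᶠ s in 𝓝[Ico 0 T \ {t}] t, ∀ᵐ p : E d × E d,
      ‖slope (fun r => entropyDensity (f r) (M r) p) t s‖ ≤ g p := by
    filter_upwards [hev, self_mem_nhdsWithin] with s hsb hsT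
    filter_upwards [hder, hbound] with p hp1 hp2
    have := (convex_Icc 0 b).norm_image_sub_le_of_norm_hasDerivWithin_le
      (f := fun r => entropyDensity (f r) (M r) p) (x := t) (y := s)
      (fun r hr => (hp1 r (hsub hr)).mono hsub) (fun r hr => hp2 r hr) ⟨ht.1, htb.le⟩ hsb
    have hne : 0 < ‖s - t‖ := norm_pos_iff.2 (sub_ne_zero.2 (by simpa using hsT.2))
    rw [slope_def_field, norm_div, div_le_iff₀ hne]
    exact this
  -- Measurability comes from the a.e. limit of the quotients along a sequence of times tending to
  -- `t`, which exists because `t < T`.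
  have hint : Integrable (entropyDt T f M t) := by
    by_cases hbot : (𝓝[Ico 0 T \ {t}] t).NeBot
    · obtain ⟨sq, hsq⟩ := exists_seq_tendsto (𝓝[Ico 0 T \ {t}] t)
      obtain ⟨N, hN⟩ := eventually_atTop.1 (hsq.eventually hmeas)
      have hsq' : Tendsto (fun n => sq (n + N)) atTop (𝓝[Ico 0 T \ {t}] t) :=
        hsq.comp (tendsto_add_atTop_nat N)
      refine hg.mono' (aestronglyMeasurable_of_tendsto_ae atTop
        (f := fun n p => slope (fun r => entropyDensity (f r) (M r) p) t (sq (n + N)))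
        (fun n => hN _ (Nat.le_add_left _ _)) ?_) ?_
      · filter_upwards [hlim] with p hp using hp.comp hsq'
      · filter_upwards [hbound] with p hp using hp t ⟨ht.1, htb.le⟩
    · exfalso
      apply hbot
      have : Ioo t T ⊆ Ico 0 T \ {t} := fun s hs =>
        ⟨⟨ht.1.trans hs.1.le, hs.2⟩, by simpa using hs.1.ne'⟩
      refine NeBot.mono ?_ (nhdsWithin_mono t this)
      rw [nhdsWithin_Ioo_eq_nhdsGT ht.2]
      infer_instance
  refine ⟨hint, ?_, by filter_upwards [hzero] with p hp using hp t ht⟩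
  rw [hasDerivWithinAt_iff_tendsto_slope]
  refine (tendsto_integral_filter_of_dominated_convergence g hmeas hdom hg hlim).congr' ?_
  filter_upwards [self_mem_nhdsWithin] with s hsT
  simp only [slope_def_field, relEntropy]
  rw [integral_div, integral_sub (hD.entropy_integrable s hsT.1) (hD.entropy_integrable t ht)]

end EntropyDerivative

/-! ### Entropy and dissipation at a fixed position -/

/-- The coercivity constant of the relative entropy in velocity and temperature. -/
noncomputable def coercivityConst (θhi Θhi : ℝ) : ℝ := 1 / (2 * θhi * (1 + 2 * (Θhi + θhi)))

theorem coercivityConst_pos {θhi Θhi : ℝ} (hθ : 0 < θhi) (hΘ : 0 < Θhi) :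
    0 < coercivityConst θhi Θhi := by
  unfold coercivityConst; positivity

/-- With `r = θ'/θ`, the bound on `r - 1 - log r` gives `(θ' - θ)² / (2θ(θ' + θ))`, and the factor
`d / 2` is lowered to `1 / 2`. The constant lies below both `1/(2θhi)` and `1/(4θhi(Θhi + θhi))`. -/
theorem coercivity_velocity_temperature (hd : 1 ≤ d) {θ θ' θhi Θhi : ℝ} (hθ : 0 < θ) (hθhi : θ ≤ θhi)
    (hθ' : 0 < θ') (hΘhi : θ' ≤ Θhi) (w : ℝ) :
    coercivityConst θhi Θhi * (w ^ 2 + (θ' - θ) ^ 2)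
      ≤ w ^ 2 / (2 * θ) + d / 2 * (θ' / θ - 1 - Real.log (θ' / θ)) := by
  have hd1 : (1 : ℝ) ≤ d := by exact_mod_cast hd
  have hhi : 0 < θhi := hθ.trans_le hθhi
  have hHi : 0 < Θhi := hθ'.trans_le hΘhi
  have h1 : coercivityConst θhi Θhi ≤ 1 / (2 * θ) := by
    unfold coercivityConst
    refine one_div_le_one_div_of_le (by positivity) ?_
    nlinarith [mul_pos hhi (add_pos hHi hhi)]
  have h2 : coercivityConst θhi Θhi ≤ 1 / (4 * (θ * (θ' + θ))) := by
    unfold coercivityConst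
    refine one_div_le_one_div_of_le (by positivity) ?_
    have : θ * (θ' + θ) ≤ θhi * (Θhi + θhi) := by gcongr
    nlinarith
  have h3 := sub_one_sub_log_ge (div_pos hθ' hθ)
  have h4 : (θ' / θ - 1) ^ 2 / (2 * (θ' / θ + 1)) = 2 * (1 / (4 * (θ * (θ' + θ))) * (θ' - θ) ^ 2) := by
    field_simp; ring
  have h5 : 0 ≤ (θ' - θ) ^ 2 := sq_nonneg _
  have h6 : coercivityConst θhi Θhi * (θ' - θ) ^ 2 ≤ 1 / (4 * (θ * (θ' + θ))) * (θ' - θ) ^ 2 := by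
    gcongr
  have h7 : coercivityConst θhi Θhi * w ^ 2 ≤ 1 / (2 * θ) * w ^ 2 := by gcongr
  have h8 : 1 / 2 * (θ' / θ - 1 - Real.log (θ' / θ)) ≤ d / 2 * (θ' / θ - 1 - Real.log (θ' / θ)) := by
    have : 0 ≤ θ' / θ - 1 - Real.log (θ' / θ) := le_trans (by positivity) h3
    gcongr
  have h9 : w ^ 2 / (2 * θ) = 1 / (2 * θ) * w ^ 2 := by ring
  rw [h9, mul_add]
  linarith

section Slice

variable {F : E d → E d → ℝ} {x : E d}

theorem density_nonneg (h0 : ∀ v, 0 ≤ F x v) : 0 ≤ density F x := integral_nonneg h0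

/-- The relative entropy at `x` controls the differences of the hydrodynamic fields. -/
theorem slice_entropy_ge (hd : 1 ≤ d) (hc : Continuous (F x)) (h0 : ∀ v, 0 ≤ F x v)
    (hF : Integrable fun v => (1 + ‖v‖ ^ 2) * F x v) {ρ θ θhi Θhi : ℝ} {u : E d} (hρ : 0 < ρ)
    (hθ : 0 < θ) (hθhi : θ ≤ θhi) (hT : 0 < temperature F x) (hThi : temperature F x ≤ Θhi)
    (hent : Integrable fun v => F x v * Real.log (F x v / maxwellian ρ u θ v)) :
    density F x - ρ + coercivityConst θhi Θhi *
        (density F x * (‖meanVelocity F x - u‖ ^ 2 + (temperature F x - θ) ^ 2))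
      ≤ ∫ v, F x v * Real.log (F x v / maxwellian ρ u θ v) := by
  by_cases hpos : 0 < density F x
  swap
  · obtain ⟨h1, h2⟩ := slice_ae_zero_of_density_nonpos hc h0 hF hpos
    have : ∫ v, F x v * Real.log (F x v / maxwellian ρ u θ v) = 0 := by
      refine integral_eq_zero_of_ae ?_
      filter_upwards [h2] with v hv
      simp [show F x v = 0 from hv]
    rw [this, h1]; simp; exact hρ.le
  set m := meanVelocity F x with hm
  set τ := temperature F x with hτ
  set r := density F x with hr
  have I0 := integrable_slice hc h0 hF
  set a := Real.log (r / ρ) - d / 2 * Real.log (τ / θ) + ‖m - u‖ ^ 2 / (2 * θ) with ha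
  set b := (1 / θ) • (m - u) with hb
  set c := 1 / (2 * θ) - 1 / (2 * τ) with hcc
  obtain ⟨Iq, Eq⟩ := integral_slice_quadratic hd hc h0 hF hpos b a c
  rw [← hm, ← hτ, ← hr] at Eq
  rw [← hm] at Iq
  have IM := integrable_maxwellian r hT m
  -- Split `log (F/M)` as `log (F/𝓜) + log (𝓜/M)`. The first contributes at least `F - 𝓜`, of zero
  -- integral; the second is a quadratic polynomial with known moments.
  have hpt : ∀ v, F x v - maxwellian r m τ v + F x v * (a + inner ℝ b (v - m) + c * ‖v - m‖ ^ 2)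
      ≤ F x v * Real.log (F x v / maxwellian ρ u θ v) := fun v => by
    have hMp := maxwellian_pos hpos hT m v
    have hMq := maxwellian_pos hρ hθ u v
    rw [← log_maxwellian_div hpos hρ hT hθ m u v]
    have h1 := mul_log_div_ge_sub (h0 v) hMp
    rw [mul_log_div_eq _ hMp] at h1
    rw [mul_log_div_eq _ hMq, Real.log_div hMp.ne' hMq.ne']
    linarith
  have J : Integrable fun v => F x v - maxwellian r m τ v := I0.sub IM
  have hint := integral_mono (J.add Iq) hent hpt
  simp only [Pi.add_apply] at hint
  rw [integral_add J Iq, integral_sub I0 IM, integral_maxwellian r hT, Eq] at hint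
  change r - r + _ ≤ _ at hint
  refine le_trans ?_ hint
  -- The density part `r log (r / ρ)` is only bounded by `r - ρ`, which has zero integral in `x`.
  have h1 := mul_log_div_ge_sub hpos.le hρ
  have h2 := mul_le_mul_of_nonneg_left
    (coercivity_velocity_temperature hd hθ hθhi hT hThi ‖m - u‖) hpos.le
  have h3 : a + c * (d * τ) = Real.log (r / ρ)
      + (‖m - u‖ ^ 2 / (2 * θ) + d / 2 * (τ / θ - 1 - Real.log (τ / θ))) := by
    rw [ha, hcc]; field_simp; ring
  rw [h3, mul_add]
  linarith

/-- Growth constant of the square of the transport polynomial. -/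
noncomputable def growthConst (d : ℕ) (θlo Ku k₁ k₂ : ℝ) : ℝ :=
  (2 * k₁ / θlo + k₂ * (1 / (2 * θlo) + (d + 2) / 2)) ^ 2 * (1 + Ku) ^ 6 * 32

/-- Sixth moment of the local equilibrium per unit density. -/
noncomputable def sixthMomentConst (d : ℕ) (U Θhi : ℝ) : ℝ :=
  32 * (384 * Θhi ^ 3 * 2 ^ ((d : ℝ) / 2) + U ^ 6)

/-- The entropy production at `x`: relaxation dominates the transport of `log M`, up to a term of
order `ε` and a term quadratic in the differences of the hydrodynamic fields. -/
theorem slice_production_le (hd : 1 ≤ d) (hc : Continuous (F x)) (h0 : ∀ v, 0 ≤ F x v)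
    (hF : Integrable fun v => (1 + ‖v‖ ^ 2) * F x v)
    (hF6 : Integrable fun v => F x v + ‖v‖ ^ 6 * F x v)
    {ρ θ θlo Θhi U Ku k₁ k₂ ε : ℝ} {u : E d} {B : E d →L[ℝ] E d} {ℓ : E d →L[ℝ] ℝ} (hε : 0 < ε)
    (hρ : 0 < ρ) (hθlo : 0 < θlo) (hθ : θlo ≤ θ) (hu : ‖u‖ ≤ Ku) (hB : ‖B‖ ≤ k₁) (hℓ : ‖ℓ‖ ≤ k₂)
    (hU : ‖meanVelocity F x‖ ≤ U)
    (hT : 0 < temperature F x) (hThi : temperature F x ≤ Θhi)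
    {Q : E d → ℝ} (hQ : Integrable Q)
    (hQe : ∀ᵐ v, Q v = -(1 / ε) * (F x v - localMaxwellian F x v)
        * (Real.log (F x v / maxwellian ρ u θ v) + 1) - F x v * transportPoly θ B ℓ (v - u))
    (hz : ∀ᵐ v, F x v = 0 → localMaxwellian F x v = 0) :
    ∫ v, Q v ≤ ε / 4 * growthConst d θlo Ku k₁ k₂
        * ((∫ v, F x v + ‖v‖ ^ 6 * F x v) + density F x * (1 + sixthMomentConst d U Θhi))
      + fluxConst d θlo k₁ k₂ (U + Ku)
        * (density F x * (‖meanVelocity F x - u‖ ^ 2 + (temperature F x - θ) ^ 2)) := by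
  have hθ0 : 0 < θ := hθlo.trans_le hθ
  have hKu : 0 ≤ Ku := (norm_nonneg u).trans hu
  have hk₁ : 0 ≤ k₁ := (norm_nonneg B).trans hB
  have hk₂ : 0 ≤ k₂ := (norm_nonneg ℓ).trans hℓ
  have hU0 : 0 ≤ U := (norm_nonneg _).trans hU
  have hΘ0 : 0 < Θhi := hT.trans_le hThi
  have hgr : 0 ≤ growthConst d θlo Ku k₁ k₂ := by unfold growthConst; positivity
  by_cases hpos : 0 < density F x
  swap
  · obtain ⟨h1, h2⟩ := slice_ae_zero_of_density_nonpos hc h0 hF hpos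
    have : ∫ v, Q v = 0 := by
      refine integral_eq_zero_of_ae ?_
      filter_upwards [h2, hQe] with v hv hq
      rw [hq, show F x v = 0 from hv, localMaxwellian, h1, maxwellian_zero_density]
      simp
    rw [this, h1]
    have : 0 ≤ ∫ v, F x v + ‖v‖ ^ 6 * F x v :=
      integral_nonneg fun v => add_nonneg (h0 v) (mul_nonneg (by positivity) (h0 v))
    simp only [zero_mul, mul_zero, add_zero]
    positivity
  set m := meanVelocity F x with hm
  set τ := temperature F x with hτ
  set r := density F x with hr
  have hloc : ∀ v, localMaxwellian F x v = maxwellian r m τ v := fun v => rfl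
  simp only [hloc] at hQe hz
  set a := Real.log (r / ρ) - d / 2 * Real.log (τ / θ) + ‖m - u‖ ^ 2 / (2 * θ) with ha
  set b := (1 / θ) • (m - u) with hb
  set c := 1 / (2 * θ) - 1 / (2 * τ) with hcc
  obtain ⟨Iq, Eq⟩ := integral_slice_quadratic hd hc h0 hF hpos b (a + 1) c
  rw [← hm, ← hτ, ← hr] at Eq
  rw [← hm] at Iq
  obtain ⟨Iq', Eq'⟩ := integral_maxwellian_quadratic r hT m b (a + 1) c
  have IM := integrable_maxwellian r hT m
  obtain ⟨IM6, EM6⟩ := integral_maxwellian_pow_six_le hpos.le hT hThi hU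
  have IP := integrable_maxwellian_mul_transportPoly (B := B) (ℓ := ℓ) hd hθ0 r hT u m
  have EP := abs_integral_maxwellian_mul_transportPoly_le (B := B) (ℓ := ℓ) hd hθlo hθ hB hℓ hpos.le hT
    (u := u) (u' := m) (W := U + Ku)
    ((norm_sub_le _ _).trans (add_le_add hU hu))
  -- This is `log (𝓜/M) + 1`, against which `F` and `𝓜` have equal integrals.
  set q : E d → ℝ := fun v => a + 1 + inner ℝ b (v - m) + c * ‖v - m‖ ^ 2 with hq
  have IS : Integrable fun v => F x v * q v - maxwellian r m τ v * q v := Iq.sub Iq'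
  have ES : ∫ v, (F x v * q v - maxwellian r m τ v * q v) = 0 := by
    rw [integral_sub Iq Iq', Eq, Eq', sub_self]
  have IMM : Integrable fun v => maxwellian r m τ v + maxwellian r m τ v * ‖v‖ ^ 6 := IM.add IM6
  have IG : Integrable fun v => (F x v + ‖v‖ ^ 6 * F x v)
      + (maxwellian r m τ v + maxwellian r m τ v * ‖v‖ ^ 6) := hF6.add IMM
  -- Adding `(1/ε)(F - 𝓜) q` leaves the integral unchanged and turns `log (F/M) + 1` into `log
  -- (F/𝓜)`. The square completion then absorbs `(F - 𝓜)P`, and only `𝓜P` stays outside.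
  have hpt : ∀ᵐ v, Q v + 1 / ε * (F x v * q v - maxwellian r m τ v * q v)
      ≤ ε / 4 * growthConst d θlo Ku k₁ k₂ * ((F x v + ‖v‖ ^ 6 * F x v)
      + (maxwellian r m τ v + maxwellian r m τ v * ‖v‖ ^ 6))
      - maxwellian r m τ v * transportPoly θ B ℓ (v - u) := by
    filter_upwards [hQe, hz] with v h1 h2
    have hMp := maxwellian_pos hpos hT m v
    have hMq := maxwellian_pos hρ hθ0 u v
    have hFp : 0 < F x v := (h0 v).lt_of_ne fun h => hMp.ne' (h2 h.symm)
    have hqv : q v = Real.log (maxwellian r m τ v / maxwellian ρ u θ v) + 1 := by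
      rw [log_maxwellian_div hpos hρ hT hθ0 m u v, hq]; ring
    have h3 := neg_dissipation_le (q := transportPoly θ B ℓ (v - u)) hFp hMp hε
    have h4 : transportPoly θ B ℓ (v - u) ^ 2 ≤ growthConst d θlo Ku k₁ k₂ * (1 + ‖v‖ ^ 6) :=
      transportPoly_sq_le hd hθlo hθ hB hℓ hKu (norm_nonneg v)
        ((norm_sub_le _ _).trans (by linarith))
    have h5 : ε / 4 * ((F x v + maxwellian r m τ v) * transportPoly θ B ℓ (v - u) ^ 2)
        ≤ ε / 4 * ((F x v + maxwellian r m τ v)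
          * (growthConst d θlo Ku k₁ k₂ * (1 + ‖v‖ ^ 6))) := by gcongr
    rw [h1, hqv]
    rw [Real.log_div hFp.ne' hMp.ne'] at h3
    rw [Real.log_div hFp.ne' hMq.ne', Real.log_div hMp.ne' hMq.ne']
    linear_combination h3 + h5
  have hI1 : Integrable fun v => Q v + 1 / ε * (F x v * q v - maxwellian r m τ v * q v) :=
    hQ.add (IS.const_mul _)
  have hint := integral_mono_ae hI1 ((IG.const_mul (ε / 4 * growthConst d θlo Ku k₁ k₂)).sub IP) hpt
  simp only [Pi.sub_apply] at hint
  rw [integral_add hQ (IS.const_mul _), integral_const_mul, ES, mul_zero, add_zero,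
    integral_sub (IG.const_mul _) IP, integral_const_mul, integral_add hF6 IMM,
    integral_add IM IM6, integral_maxwellian r hT] at hint
  have h6 := (abs_le.1 EP).1
  have h7 : r + ∫ v, maxwellian r m τ v * ‖v‖ ^ 6 ≤ r * (1 + sixthMomentConst d U Θhi) := by
    unfold sixthMomentConst; linarith
  have h8 : ε / 4 * growthConst d θlo Ku k₁ k₂
      * ((∫ v, F x v + ‖v‖ ^ 6 * F x v) + (r + ∫ v, maxwellian r m τ v * ‖v‖ ^ 6))
      ≤ ε / 4 * growthConst d θlo Ku k₁ k₂
      * ((∫ v, F x v + ‖v‖ ^ 6 * F x v) + r * (1 + sixthMomentConst d U Θhi)) := by gcongr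
  linarith

end Slice

/-! ### The relative entropy inequality -/

section Global

variable {T θlo θhi U Θlo Θhi A Ku Kdu Kdθ ε : ℝ} {ρ : ℝ → E d → ℝ} {u : ℝ → E d → E d}
  {θ : ℝ → E d → ℝ} {f : ℝ → E d → E d → ℝ}

theorem measurable_targetMaxwellian (h : IsEulerSolution T ρ u θ) {t : ℝ} (ht : t ∈ Ico 0 T) :
    Measurable fun p : E d × E d => targetMaxwellian ρ u θ t p.1 p.2 := by
  have h1 : Measurable (ρ t) := (contDiff_space_slice h.smooth_density ht).continuous.measurable
  have h2 : Measurable (u t) := (contDiff_space_slice h.smooth_velocity ht).continuous.measurable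
  have h3 : Measurable (θ t) := (contDiff_space_slice h.smooth_temperature ht).continuous.measurable
  unfold targetMaxwellian maxwellian
  fun_prop

theorem integrable_of_integral_eq_one {α : Type*} [MeasurableSpace α] {μ : Measure α} {g : α → ℝ}
    (h : ∫ x, g x ∂μ = 1) : Integrable g μ := by
  by_contra hn
  rw [integral_undef hn] at h
  exact zero_ne_one h

/-- Coefficient of `ε` in the relative entropy inequality. -/
noncomputable def relaxationConst (d : ℕ) (θlo U Θhi A Ku Kdu Kdθ : ℝ) : ℝ :=
  1 / 4 * growthConst d θlo Ku Kdu Kdθ * ((1 + A) + (1 + sixthMomentConst d U Θhi))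

/-- Coefficient of the relative entropy in the relative entropy inequality. -/
noncomputable def stabilityConst (d : ℕ) (θlo θhi U Θhi Ku Kdu Kdθ : ℝ) : ℝ :=
  fluxConst d θlo Kdu Kdθ (U + Ku) / coercivityConst θhi Θhi

/-- The position-wise estimates are integrated in `x`. Nonnegativity of the entropy is included so
that its coefficient can later be enlarged. -/
theorem relEntropy_inequality (hd : 1 ≤ d) (hθlo : 0 < θlo) (hΘlo : 0 < Θlo) (hε : 0 < ε)
    (hbg : EulerBackground T θlo θhi Ku Kdu Kdθ ρ u θ) (hf : IsBGKSolution T ε f)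
    (hb : BGKBounds T U Θlo Θhi A f) (hD : SufficientDecay T f (targetMaxwellian ρ u θ))
    {t : ℝ} (ht : t ∈ Ico 0 T) :
    0 ≤ relEntropy (f t) (targetMaxwellian ρ u θ t) ∧
    ∃ H' : ℝ, HasDerivWithinAt (fun s => relEntropy (f s) (targetMaxwellian ρ u θ s)) H' (Ico 0 T) t ∧
      H' ≤ relaxationConst d θlo U Θhi A Ku Kdu Kdθ * ε
        + stabilityConst d θlo θhi U Θhi Ku Kdu Kdθ
          * relEntropy (f t) (targetMaxwellian ρ u θ t) := by
  have hθpos : ∀ t ∈ Ico 0 T, ∀ x, 0 < θ t x := fun t ht x =>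
    hθlo.trans_le (hbg.temperature_mem t ht x).1
  have hρpos := hbg.density_pos
  set M := targetMaxwellian ρ u θ with hMdef
  have hM0 : ∀ t ∈ Ico 0 T, ∀ x v, 0 < M t x v := fun t ht x v =>
    maxwellian_pos (hρpos t ht x) (hθpos t ht x) _ _
  have hMt : ∀ t ∈ Ico 0 T, ∀ x v,
      DifferentiableWithinAt ℝ (fun s => Real.log (M s x v)) (Ico 0 T) t := fun t ht x v =>
    hbg.euler.differentiableWithinAt_log_maxwellian hρpos hθpos ht x v
  have hMx : ∀ t ∈ Ico 0 T, ∀ x v, DifferentiableAt ℝ (fun y => Real.log (M t y v)) x :=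
    fun t ht x v => hbg.euler.differentiableAt_log_maxwellian hρpos hθpos ht x v
  have hMm : ∀ t ∈ Ico 0 T, Measurable fun p : E d × E d => M t p.1 p.2 := fun t ht =>
    measurable_targetMaxwellian hbg.euler ht
  have hθhi : 0 < θhi := (hθpos t ht 0).trans_le (hbg.temperature_mem t ht 0).2
  have hτpos : ∀ x, 0 < temperature (f t) x := fun x => hΘlo.trans_le (hb.temperature_mem t ht x).1
  have hΘhi : 0 < Θhi := (hτpos 0).trans_le (hb.temperature_mem t ht 0).2
  have hκ := coercivityConst_pos hθhi hΘhi
  have hKdu : 0 ≤ Kdu := (norm_nonneg _).trans (hbg.grad_velocity_le t ht 0)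
  have hKdθ : 0 ≤ Kdθ := (norm_nonneg _).trans (hbg.grad_log_temperature_le t ht 0)
  have hKu : 0 ≤ Ku := (norm_nonneg _).trans (hbg.velocity_le t ht 0)
  have hU : 0 ≤ U := (norm_nonneg _).trans (hb.velocity_le t ht 0)
  have hflux : 0 ≤ fluxConst d θlo Kdu Kdθ (U + Ku) := by unfold fluxConst; positivity
  have hgr : 0 ≤ growthConst d θlo Ku Kdu Kdθ := by unfold growthConst; positivity
  have hcont : ∀ x, Continuous (f t x) := fun x =>
    (contDiff_phase_slice hf.smooth ht).continuous.comp (continuous_const.prodMk continuous_id)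
  have hnn : ∀ x v, 0 ≤ f t x v := hf.nonneg t ht
  have hmom := hf.finite_moments t ht
  -- integrability on phase space and of the marginals
  have If : Integrable (fun p : E d × E d => f t p.1 p.2) (volume.prod volume) :=
    integrable_of_integral_eq_one (hf.unit_mass t ht)
  have I6 : Integrable (fun p : E d × E d => f t p.1 p.2 + ‖p.2‖ ^ 6 * f t p.1 p.2)
      (volume.prod volume) := If.add (hb.sixth_moment_integrable t ht)
  have Ie : Integrable (entropyDensity (f t) (M t)) (volume.prod volume) := hD.entropy_integrable t ht
  have Iρ : Integrable (ρ t) := integrable_of_integral_eq_one (hbg.unit_mass t ht)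
  have Ifx : Integrable (density (f t)) := If.integral_prod_left
  have I6x : Integrable fun x => ∫ v, f t x v + ‖v‖ ^ 6 * f t x v := I6.integral_prod_left
  have Iex : Integrable fun x => ∫ v, entropyDensity (f t) (M t) (x, v) := Ie.integral_prod_left
  have Efx : ∫ x, density (f t) x = 1 := by
    rw [← hf.unit_mass t ht]; exact (integral_prod _ If).symm
  have E6x : ∫ x, ∫ v, f t x v + ‖v‖ ^ 6 * f t x v ≤ 1 + A := by
    rw [← integral_prod (fun p : E d × E d => f t p.1 p.2 + ‖p.2‖ ^ 6 * f t p.1 p.2) I6,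
      integral_add If (hb.sixth_moment_integrable t ht)]
    exact add_le_add (hf.unit_mass t ht).le (hb.sixth_moment_le t ht)
  have Eex : ∫ x, ∫ v, entropyDensity (f t) (M t) (x, v) = relEntropy (f t) (M t) :=
    (integral_prod _ Ie).symm
  have hslice : ∀ᵐ x, density (f t) x - ρ t x + coercivityConst θhi Θhi *
        (density (f t) x * (‖meanVelocity (f t) x - u t x‖ ^ 2 + (temperature (f t) x - θ t x) ^ 2))
      ≤ ∫ v, entropyDensity (f t) (M t) (x, v) := by
    filter_upwards [Ie.prod_right_ae] with x hx
    exact slice_entropy_ge hd (hcont x) (hnn x) (hmom x) (hρpos t ht x) (hθpos t ht x)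
      (hbg.temperature_mem t ht x).2 (hτpos x) (hb.temperature_mem t ht x).2 hx
  have hH0 : 0 ≤ relEntropy (f t) (M t) := by
    rw [← Eex]
    calc (0 : ℝ) = ∫ x, (density (f t) x - ρ t x) := by
          rw [integral_sub Ifx Iρ, Efx, hbg.unit_mass t ht, sub_self]
      _ ≤ _ := by
          refine integral_mono_ae (Ifx.sub Iρ) Iex ?_
          filter_upwards [hslice] with x hx
          refine le_trans ?_ hx
          have h1 := density_nonneg (hnn x)
          have : 0 ≤ coercivityConst θhi Θhi * (density (f t) x *
            (‖meanVelocity (f t) x - u t x‖ ^ 2 + (temperature (f t) x - θ t x) ^ 2)) := by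
            positivity
          linarith
  refine ⟨hH0, ?_⟩
  obtain ⟨It, hder, hz⟩ := hasDerivWithinAt_relEntropy hf.smooth hf.nonneg hM0 hMt hD ht
  have Ix := integrable_entropyDx hf.smooth hf.nonneg hM0 hMm hMx hD ht
  have Ex := integral_entropyDx hf.smooth hf.nonneg hM0 hMm hMx hD ht
  refine ⟨_, hder, ?_⟩
  have IQ : Integrable (fun p => entropyDt T f M t p + entropyDx f M t p)
      (volume.prod volume : Measure (E d × E d)) := It.add Ix
  -- The transport derivative has zero integral and is added so that the BGK and Euler equations can
  -- be used pointwise.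
  have hQ : ∫ p, entropyDt T f M t p
      = ∫ x, ∫ v, entropyDt T f M t (x, v) + entropyDx f M t (x, v) := by
    rw [← integral_prod _ IQ, ← Measure.volume_eq_prod, integral_add It Ix, Ex, add_zero]
  rw [hQ]
  have hQe : ∀ x v, entropyDt T f M t (x, v) + entropyDx f M t (x, v)
      = -(1 / ε) * (f t x v - localMaxwellian (f t) x v)
        * (Real.log (f t x v / maxwellian (ρ t x) (u t x) (θ t x) v) + 1)
        - f t x v * transportPoly (θ t x) (fderiv ℝ (u t) x)
          (fderiv ℝ (fun y => Real.log (θ t y)) x) (v - u t x) := fun x v => by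
    rw [← hf.equation t ht x v, ← hbg.euler.transport_log_maxwellian hd hρpos hθpos ht x v]
    simp only [entropyDt, entropyDx, hMdef, targetMaxwellian]
    ring
  -- At a zero of `f` both derivatives on the left of the BGK equation vanish, hence so does the
  -- local Maxwellian.
  have hz' : ∀ᵐ x, ∀ᵐ v, f t x v = 0 → localMaxwellian (f t) x v = 0 := by
    rw [Measure.volume_eq_prod] at hz
    filter_upwards [Measure.ae_ae_of_ae_prod hz] with x hx
    filter_upwards [hx] with v hv h
    have h1 := hf.equation t ht x v
    rw [hv h, dirDeriv_eq_zero_of_eq_zero hf.nonneg ht h v, h] at h1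
    have : ε ≠ 0 := hε.ne'
    field_simp at h1
    linarith
  -- Subtracting `density - ρ` isolates the part of the entropy that controls the velocity and
  -- temperature differences; by equality of masses it leaves the integral equal to the relative
  -- entropy.
  set R : E d → ℝ := fun x => ε / 4 * growthConst d θlo Ku Kdu Kdθ
      * ((∫ v, f t x v + ‖v‖ ^ 6 * f t x v) + density (f t) x * (1 + sixthMomentConst d U Θhi))
    + stabilityConst d θlo θhi U Θhi Ku Kdu Kdθ
      * ((∫ v, entropyDensity (f t) (M t) (x, v)) - (density (f t) x - ρ t x)) with hR
  have IR1 : Integrable fun x => (∫ v, f t x v + ‖v‖ ^ 6 * f t x v)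
      + density (f t) x * (1 + sixthMomentConst d U Θhi) := I6x.add (Ifx.mul_const _)
  have Id : Integrable fun x => density (f t) x - ρ t x := Ifx.sub Iρ
  have IR2 : Integrable fun x => (∫ v, entropyDensity (f t) (M t) (x, v))
      - (density (f t) x - ρ t x) := Iex.sub Id
  have IR : Integrable R := (IR1.const_mul _).add (IR2.const_mul _)
  have hle : ∫ x, ∫ v, entropyDt T f M t (x, v) + entropyDx f M t (x, v) ≤ ∫ x, R x := by
    refine integral_mono_ae IQ.integral_prod_left IR ?_
    filter_upwards [IQ.prod_right_ae, I6.prod_right_ae, hz', hslice] with x h1 h2 h3 h4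
    have h5 := slice_production_le hd (hcont x) (hnn x) (hmom x) h2 hε (hρpos t ht x) hθlo
      (hbg.temperature_mem t ht x).1 (hbg.velocity_le t ht x) (hbg.grad_velocity_le t ht x)
      (hbg.grad_log_temperature_le t ht x) (hb.velocity_le t ht x) (hτpos x)
      (hb.temperature_mem t ht x).2 h1 (Eventually.of_forall (hQe x)) h3
    refine h5.trans (add_le_add le_rfl ?_)
    unfold stabilityConst
    rw [div_mul_eq_mul_div, le_div_iff₀ hκ, mul_assoc]
    refine mul_le_mul_of_nonneg_left ?_ hflux
    linarith
  refine hle.trans ?_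
  rw [hR, integral_add (IR1.const_mul _) (IR2.const_mul _), integral_const_mul, integral_const_mul,
    integral_add I6x (Ifx.mul_const _), integral_mul_const, integral_sub Iex Id,
    integral_sub Ifx Iρ, Efx, hbg.unit_mass t ht, Eex, sub_self, sub_zero, one_mul]
  refine add_le_add ?_ le_rfl
  have : ε / 4 * growthConst d θlo Ku Kdu Kdθ * ((∫ x, ∫ v, f t x v + ‖v‖ ^ 6 * f t x v)
      + (1 + sixthMomentConst d U Θhi)) ≤ ε / 4 * growthConst d θlo Ku Kdu Kdθ
      * ((1 + A) + (1 + sixthMomentConst d U Θhi)) := by gcongr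
  refine this.trans (le_of_eq ?_)
  unfold relaxationConst; ring

end Global

end BGK

/-! ### Uniform constant, Gronwall and the limit `ε → 0`. -/

theorem mainTheorem1 (d : ℕ) (hd : 1 ≤ d)
    (θlo θhi U Θlo Θhi A Ku Kdu Kdθ : ℝ)
    (hθlo : 0 < θlo) (hθ : θlo ≤ θhi) (hU : 0 < U)
    (hΘlo : 0 < Θlo) (hΘ : Θlo ≤ Θhi) (hA : 0 < A) :
    ∃ C : ℝ, 0 < C ∧
      ∀ (T : ℝ), 0 < T →
      ∀ (ρ : ℝ → BGK.E d → ℝ) (u : ℝ → BGK.E d → BGK.E d) (θ : ℝ → BGK.E d → ℝ),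
      BGK.EulerBackground T θlo θhi Ku Kdu Kdθ ρ u θ →
      ∀ (I : Set ℝ), I ⊆ Ioi 0 →
      ∀ (f : ℝ → ℝ → BGK.E d → BGK.E d → ℝ),
      (∀ ε ∈ I, BGK.IsBGKSolution T ε (f ε)) →
      (∀ ε ∈ I, BGK.BGKBounds T U Θlo Θhi A (f ε)) →
      (∀ ε ∈ I, BGK.SufficientDecay T (f ε) (BGK.targetMaxwellian ρ u θ)) →
      (∀ ε ∈ I, ∀ t ∈ Ico 0 T,
        DifferentiableWithinAt ℝ
          (fun s => BGK.relEntropy (f ε s) (BGK.targetMaxwellian ρ u θ s)) (Ico 0 T) t ∧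
        derivWithin
          (fun s => BGK.relEntropy (f ε s) (BGK.targetMaxwellian ρ u θ s)) (Ico 0 T) t
          ≤ C * (BGK.relEntropy (f ε t) (BGK.targetMaxwellian ρ u θ t) + ε)) ∧
      (Tendsto (fun ε => BGK.relEntropy (f ε 0) (BGK.targetMaxwellian ρ u θ 0))
          (𝓝[I] 0) (𝓝 0) →
        Tendsto (fun ε => ⨆ t ∈ Ico 0 T,
            ((BGK.relEntropy (f ε t) (BGK.targetMaxwellian ρ u θ t) : ℝ) : EReal))
          (𝓝[I] 0) (𝓝 0)) := by
  set C₁ := BGK.relaxationConst d θlo U Θhi A Ku Kdu Kdθ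
  set C₂ := BGK.stabilityConst d θlo θhi U Θhi Ku Kdu Kdθ
  -- The entry 1 ensures positivity; neither `C₁` nor `C₂` involves `T`, `ε` or the solutions.
  set C := max 1 (max C₁ C₂) with hC
  have hC₁ : C₁ ≤ C := (le_max_left _ _).trans (le_max_right _ _)
  have hC₂ : C₂ ≤ C := (le_max_right _ _).trans (le_max_right _ _)
  have hC0 : 0 < C := one_pos.trans_le (le_max_left _ _)
  refine ⟨C, hC0, fun T hT ρ u θ hbg I hI f hf hb hD => ?_⟩
  have key := fun ε (hε : ε ∈ I) t (ht : t ∈ Ico 0 T) =>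
    BGK.relEntropy_inequality hd hθlo hΘlo (hI hε) hbg (hf ε hε) (hb ε hε) (hD ε hε) ht
  have hmain : ∀ ε ∈ I, ∀ t ∈ Ico 0 T,
      DifferentiableWithinAt ℝ
        (fun s => BGK.relEntropy (f ε s) (BGK.targetMaxwellian ρ u θ s)) (Ico 0 T) t ∧
      derivWithin
        (fun s => BGK.relEntropy (f ε s) (BGK.targetMaxwellian ρ u θ s)) (Ico 0 T) t
        ≤ C * (BGK.relEntropy (f ε t) (BGK.targetMaxwellian ρ u θ t) + ε) := by
    intro ε hε t ht
    obtain ⟨h0, H', h1, h2⟩ := key ε hε t ht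
    refine ⟨h1.differentiableWithinAt, ?_⟩
    rw [h1.derivWithin (uniqueDiffOn_Ico 0 T t ht)]
    have hε0 : 0 < ε := hI hε
    have e1 := mul_le_mul_of_nonneg_right hC₁ hε0.le
    have e2 := mul_le_mul_of_nonneg_right hC₂ h0
    linarith
  refine ⟨hmain, fun h0 => ?_⟩
  have h0T : (0 : ℝ) ∈ Ico 0 T := ⟨le_rfl, hT⟩
  have hup : Tendsto (fun ε => (((BGK.relEntropy (f ε 0) (BGK.targetMaxwellian ρ u θ 0) + ε)
      * Real.exp (C * T) : ℝ) : EReal)) (𝓝[I] 0) (𝓝 0) := by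
    have h1 : Tendsto (fun ε : ℝ => ε) (𝓝[I] 0) (𝓝 0) := tendsto_id.mono_left nhdsWithin_le_nhds
    have h2 := (h0.add h1).mul_const (Real.exp (C * T))
    rw [add_zero, zero_mul] at h2
    exact (continuous_coe_real_ereal.tendsto 0).comp h2
  -- Squeeze in `EReal`: the supremum is at least the nonnegative value at `t = 0` and at most the
  -- Gronwall bound with `e^(Ct)` replaced by `e^(CT)`. An empty inner supremum is `⊥`, so times
  -- outside `[0, T)` do not contribute.
  refine tendsto_of_tendsto_of_tendsto_of_le_of_le' tendsto_const_nhds hup ?_ ?_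
  · filter_upwards [self_mem_nhdsWithin] with ε hε
    refine le_iSup₂_of_le 0 h0T ?_
    exact_mod_cast (key ε hε 0 h0T).1
  · filter_upwards [self_mem_nhdsWithin] with ε hε
    refine iSup₂_le fun t ht => ?_
    have hε0 : 0 < ε := hI hε
    have hg := BGK.gronwall_of_derivWithin_le (fun t ht => (hmain ε hε t ht).1)
      (fun t ht => (hmain ε hε t ht).2) ht
    have hexp : Real.exp (C * t) ≤ Real.exp (C * T) := by
      have := ht.2.le
      gcongr
    have h1 := mul_le_mul_of_nonneg_left hexp (add_nonneg (key ε hε 0 h0T).1 hε0.le)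
    have : BGK.relEntropy (f ε t) (BGK.targetMaxwellian ρ u θ t)
        ≤ (BGK.relEntropy (f ε 0) (BGK.targetMaxwellian ρ u θ 0) + ε) * Real.exp (C * T) := by
      linarith
    exact_mod_cast this
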